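/- Let $k>2$ be an integer and let $0<\epsilon\le 1/2$ be a real number, both constant. For a simple graph $G$ on the vertex set $\{1,\dots,n\}$ let $H_n(G)\in\mathbb{Z}_2$ be the number of $k$-cliques of $G$ modulo $2$. Sample a set $S$ uniformly at random among all sets of $\lfloor(1/2+\epsilon)2^{\binom n2}\rfloor$ simple graphs on $\{1,\dots,n\}$; an oracle $O$, mapping the simple graphs on $\{1,\dots,n\}$ to $\mathbb{Z}_2$, is called correct on $S$ if $O(G)=H_n(G)$ for all $G\in S$ (its values outside $S$ are arbitrary and may be chosen adversarially, depending on $S$). Then there is a randomized oracle algorithm $A$, depending only on $k$ and $\epsilon$, that on every $n$-vertex input graph, with every oracle and for all outcomes of its coin tosses, halts in time $\tilde O(n^2)$, that is, $O(n^2(\log n)^d)$ for a constant $d$ (on a random access machine with logarithmic cost and fair coin tosses, on which a query about an $n$-vertex graph is charged at least $n^2$), such that, for all sufficiently large $n$, with probability at least $1-2^{-\Omega(n^2)}$ over $S$ the following holds: for every oracle $O$ that is correct on $S$ and every simple graph $G$ on $\{1,\dots,n\}$, the algorithm $A$ with oracle $O$ outputs $H_n(G)$ on input $G$ with probability greater than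 $2/3$ over its coin tosses. -/

import Mathlib

/-! ## Clique parity -/

/-- The number of `k`-cliques of the simple graph `G` on `n` labelled vertices, modulo `2`. -/
noncomputable def cliqueParity (k : ℕ) {n : ℕ} (G : SimpleGraph (Fin n)) : ZMod 2 :=
  ({s : Finset (Fin n) | G.IsNClique k s}.ncard : ZMod 2)

/-! ## Uniform probability on a finite set -/

open Classical in
/-- The probability of the event `E` for a uniformly random element of the finite set `Ω`. -/
noncomputable def uniformProb {α : Type*} (Ω : Finset α) (E : α → Prop) : ℝ :=
  ((Ω.filter E).card : ℝ) / (Ω.card : ℝ)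

open Classical in
/-- The sample space of the random oracle experiment with correctness fraction `c`: all sets `S` of
`c * 2 ^ (n choose 2)` graphs on `n` labelled vertices (rounded down to an integer). -/
noncomputable def correctSets (n : ℕ) (c : ℝ) : Finset (Finset (SimpleGraph (Fin n))) :=
  Finset.powersetCard ⌊c * (2 : ℝ) ^ (n.choose 2)⌋₊ Finset.univ

/-! ## Randomized oracle random access machines with logarithmic cost

A machine has registers `reg 0, reg 1, …` (a program names only finitely many of them) and a random
access memory `mem 0, mem 1, …`, all holding natural numbers. The cost of an instruction is measured
in terms of the binary lengths `Nat.size` of all the numbers and addresses that it handles. -/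

/-- The arithmetic operations (subtraction is truncated, division rounds down). -/
inductive ArithOp where
  | add
  | sub
  | mul
  | div
  | mod

/-- The value of an arithmetic operation. -/
def ArithOp.eval : ArithOp → ℕ → ℕ → ℕ
  | .add, a, b => a + b
  | .sub, a, b => a - b
  | .mul, a, b => a * b
  | .div, a, b => a / b
  | .mod, a, b => a % b

/-- The cost of an arithmetic operation: linear in the binary length of the operands for addition
and subtraction, and the cost of the schoolbook method for the other operations. -/
def ArithOp.cost : ArithOp → ℕ → ℕ → ℕ
  | .add, a, b => 1 + a.size + b.size
  | .sub, a, b => 1 + a.size + b.size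
  | .mul, a, b => (1 + a.size) * (1 + b.size)
  | .div, a, b => (1 + a.size) * (1 + b.size)
  | .mod, a, b => (1 + a.size) * (1 + b.size)

/-- Programs. All arguments are fixed numbers: names of registers, except for `v` in `const d v`. -/
inductive RamProg where
  /-- `reg d := v` -/
  | const (d v : ℕ)
  /-- `reg d := op (reg a) (reg b)` -/
  | arith (op : ArithOp) (d a b : ℕ)
  /-- `reg d := mem (reg a)` -/
  | load (d a : ℕ)
  /-- `mem (reg a) := reg b` -/
  | store (a b : ℕ)
  /-- `reg d :=` a fresh fair coin -/
  | coin (d : ℕ)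
  /-- `reg d :=` the oracle's answer on the graph whose adjacency matrix starts at `mem (reg a)` -/
  | query (d a : ℕ)
  /-- first `p`, then `q` -/
  | seq (p q : RamProg)
  /-- if `reg r ≠ 0` then `p` else `q` -/
  | ite (r : ℕ) (p q : RamProg)
  /-- while `reg r ≠ 0` do `p` -/
  | loop (r : ℕ) (p : RamProg)

/-- A machine state; `tossed` is the number of coins that have been tossed so far. -/
structure RamState where
  reg : ℕ → ℕ
  mem : ℕ → ℕ
  tossed : ℕ

/-- The graph on `n` vertices whose adjacency matrix is stored row by row in the `n * n` memory cells
from `base` on. (An entry counts as an edge if it is nonzero; diagonal entries are ignored, and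
`{i, j}` is an edge if at least one of the entries `(i, j)` and `(j, i)` is nonzero, so that every
memory content represents a graph.) -/
def storedGraph (n : ℕ) (mem : ℕ → ℕ) (base : ℕ) : SimpleGraph (Fin n) :=
  SimpleGraph.fromRel fun i j => mem (base + i * n + j) ≠ 0

/-- `Exec O ρ P s s' t`: with oracle `O` and coin sequence `ρ`, the program `P` started in state `s`
halts in state `s'`, and its total cost is `t`. A query is charged the full length `n ^ 2` of the
adjacency matrix of the queried graph. -/
inductive Exec {n : ℕ} (O : SimpleGraph (Fin n) → ZMod 2) (ρ : ℕ → Bool) :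
    RamProg → RamState → RamState → ℕ → Prop where
  | const (d v : ℕ) (s : RamState) :
      Exec O ρ (.const d v) s { s with reg := Function.update s.reg d v } (1 + v.size)
  | arith (op : ArithOp) (d a b : ℕ) (s : RamState) :
      Exec O ρ (.arith op d a b) s
        { s with reg := Function.update s.reg d (op.eval (s.reg a) (s.reg b)) }
        (op.cost (s.reg a) (s.reg b))
  | load (d a : ℕ) (s : RamState) :
      Exec O ρ (.load d a) s { s with reg := Function.update s.reg d (s.mem (s.reg a)) }
        (1 + (s.reg a).size + (s.mem (s.reg a)).size)
  | store (a b : ℕ) (s : RamState) :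
      Exec O ρ (.store a b) s { s with mem := Function.update s.mem (s.reg a) (s.reg b) }
        (1 + (s.reg a).size + (s.reg b).size)
  | coin (d : ℕ) (s : RamState) :
      Exec O ρ (.coin d) s
        { s with reg := Function.update s.reg d (ρ s.tossed).toNat, tossed := s.tossed + 1 } 1
  | query (d a : ℕ) (s : RamState) :
      Exec O ρ (.query d a) s
        { s with reg := Function.update s.reg d (O (storedGraph n s.mem (s.reg a))).val }
        (1 + (s.reg a).size + n ^ 2)
  | seq {p q : RamProg} {s s' s'' : RamState} {t t' : ℕ} :
      Exec O ρ p s s' t → Exec O ρ q s' s'' t' → Exec O ρ (.seq p q) s s'' (t + t')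
  | ite_true {r : ℕ} {p q : RamProg} {s s' : RamState} {t : ℕ} :
      s.reg r ≠ 0 → Exec O ρ p s s' t → Exec O ρ (.ite r p q) s s' (1 + (s.reg r).size + t)
  | ite_false {r : ℕ} {p q : RamProg} {s s' : RamState} {t : ℕ} :
      s.reg r = 0 → Exec O ρ q s s' t → Exec O ρ (.ite r p q) s s' (1 + t)
  | loop_done {r : ℕ} {p : RamProg} {s : RamState} :
      s.reg r = 0 → Exec O ρ (.loop r p) s s 1
  | loop_step {r : ℕ} {p : RamProg} {s s' s'' : RamState} {t t' : ℕ} :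
      s.reg r ≠ 0 → Exec O ρ p s s' t → Exec O ρ (.loop r p) s' s'' t' →
        Exec O ρ (.loop r p) s s'' (1 + (s.reg r).size + t + t')

/-- Given the oracle and the coins, a run is deterministic: final state and cost are unique. -/
theorem Exec.deterministic {n : ℕ} {O : SimpleGraph (Fin n) → ZMod 2} {ρ : ℕ → Bool}
    {P : RamProg} {s s₁ s₂ : RamState} {t₁ t₂ : ℕ}
    (h₁ : Exec O ρ P s s₁ t₁) (h₂ : Exec O ρ P s s₂ t₂) : s₁ = s₂ ∧ t₁ = t₂ := by
  induction h₁ generalizing s₂ t₂ with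
  | const | arith | load | store | coin | query => cases h₂; exact ⟨rfl, rfl⟩
  | seq _ _ ih ih' =>
    cases h₂ with
    | seq h h' =>
      obtain ⟨rfl, rfl⟩ := ih h
      obtain ⟨rfl, rfl⟩ := ih' h'
      exact ⟨rfl, rfl⟩
  | ite_true hr _ ih =>
    cases h₂ with
    | ite_true _ h =>
      obtain ⟨rfl, rfl⟩ := ih h
      exact ⟨rfl, rfl⟩
    | ite_false hr' _ => exact absurd hr' hr
  | ite_false hr _ ih =>
    cases h₂ with
    | ite_true hr' _ => exact absurd hr hr'
    | ite_false _ h =>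
      obtain ⟨rfl, rfl⟩ := ih h
      exact ⟨rfl, rfl⟩
  | loop_done hr =>
    cases h₂ with
    | loop_done _ => exact ⟨rfl, rfl⟩
    | loop_step hr' _ _ => exact absurd hr hr'
  | loop_step hr _ _ ih ih' =>
    cases h₂ with
    | loop_done hr' => exact absurd hr' hr
    | loop_step _ h h' =>
      obtain ⟨rfl, rfl⟩ := ih h
      obtain ⟨rfl, rfl⟩ := ih' h'
      exact ⟨rfl, rfl⟩

open Classical in
/-- The initial state on input `G`: register `0` holds the number `n` of vertices, and the memory
cells `0, …, n * n - 1` hold the adjacency matrix of `G` row by row; everything else is `0`. -/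
noncomputable def initState {n : ℕ} (G : SimpleGraph (Fin n)) : RamState where
  reg := Function.update (fun _ => 0) 0 n
  mem := fun a => if ∃ i j : Fin n, a = i * n + j ∧ G.Adj i j then 1 else 0
  tossed := 0

/-- On input `G`, with oracle `O` and coins `ρ`, the program halts with cost at most `T`. -/
def RamProg.HaltsWithin (P : RamProg) {n : ℕ} (O : SimpleGraph (Fin n) → ZMod 2)
    (G : SimpleGraph (Fin n)) (ρ : ℕ → Bool) (T : ℕ) : Prop :=
  ∃ s t, Exec O ρ P (initState G) s t ∧ t ≤ T

/-- On input `G`, with oracle `O` and coins `ρ`, the program halts with `v` in register `0`. -/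
def RamProg.Outputs (P : RamProg) {n : ℕ} (O : SimpleGraph (Fin n) → ZMod 2)
    (G : SimpleGraph (Fin n)) (ρ : ℕ → Bool) (v : ℕ) : Prop :=
  ∃ s t, Exec O ρ P (initState G) s t ∧ s.reg 0 = v

/-- A finite coin sequence as an infinite one, padded with `false`. -/
def padCoins {m : ℕ} (r : Fin m → Bool) : ℕ → Bool :=
  fun i => if h : i < m then r ⟨i, h⟩ else false

/-- The probability that `P` with oracle `O` outputs `v` on input `G`, over `m` independent fair
coins. (For a program that always halts with cost at most `m` these are all the coins it can use,
because every toss costs `1`.) -/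
noncomputable def RamProg.outputProb (P : RamProg) {n : ℕ} (O : SimpleGraph (Fin n) → ZMod 2)
    (G : SimpleGraph (Fin n)) (m v : ℕ) : ℝ :=
  uniformProb (Finset.univ : Finset (Fin m → Bool)) fun r => P.Outputs O G (padCoins r) v

/-!
The number of `k`-cliques modulo `2` is a polynomial over `𝔽₂` of degree `k choose 2` in the
indicators of the edges. For a large constant `m`, depending only on `k` and `ε`, the algorithm
draws `m` random graphs `w` and queries the oracle at all points other than the input `G` of the
affine space `G + ∑ l, x l • w l`. On this space the parity is a low degree function of `x`
(`lowDegree`), of which the value at `x = 0` is wanted.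

A set of points is called reliable (`IsReliable`) if no low degree function that is nonzero at the
origin has half or more of its support outside of the set. If the points in `S` are a reliable
set, then the answers there determine the value at the origin, whatever the other answers are
(`decode_eq`): two reliable sets leading to different values would both contain the majority of
the points where the corresponding low degree functions differ. So the algorithm outputs the value
at the origin of any low degree function that agrees with the answers on some reliable set, which
is a constant-size decision tree.

For random `S` of density above `1 / 2` and distinct query points, reliability fails with small
probability: a low degree function that is nonzero at the origin has a support of at least `2 ^ m
/ 2 ^ (deg + 1)` points (`card_le_card_support_lowDegree`), so by a Chernoff bound a given one is
bad with probability `exp (-Ω(2 ^ m))`, and there are only `2 ^ poly(m)` of them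
(`bernoulliMean_failureRate_le`). Hence for each `G` the mean over `S` of the proportion of bad
`w` (`failureRate`) is at most `1 / 8`. Each nonzero point of the affine space is uniformly
distributed, so that no graph influences this proportion by more than `2 ^ m / 2 ^ (n choose 2)`,
and the method of bounded differences (`bernoulliMean_exp_le`) shows that the proportion reaches
`1 / 3` only with probability `exp (-Ω(2 ^ (n choose 2)))`. This survives the union bound over the
`2 ^ (n choose 2)` inputs `G` as well as the passage from independent membership in `S` to sets of
fixed size, which costs a factor of `2 ^ (n choose 2) + 1` (`uniformProb_powersetCard_le`).

The program writes all query matrices in a single pass over the `n ^ 2` cells of the input, with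
constantly many instructions per cell on numbers of `O(log n)` bits (`reaches_decodeProg`,
`isBigO_decodeCost`).
-/

open Finset

/-! ### Random subsets -/

/-- The mean of `F S` when `S` contains each element of `A` independently with probability `p`. -/
noncomputable def bernoulliMean {α : Type*} (p : ℝ) (A : Finset α) (F : Finset α → ℝ) : ℝ :=
  ∑ S ∈ A.powerset, p ^ #S * (1 - p) ^ (#A - #S) * F S

section bernoulliMean

variable {α : Type*} {p : ℝ}

theorem bernoulliMean_mono (hp : 0 ≤ p) (hp' : p ≤ 1) (A : Finset α) {F F' : Finset α → ℝ}
    (h : ∀ S ⊆ A, F S ≤ F' S) : bernoulliMean p A F ≤ bernoulliMean p A F' := by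
  refine Finset.sum_le_sum fun S hS => ?_
  have : 0 ≤ 1 - p := by linarith
  exact mul_le_mul_of_nonneg_left (h S (mem_powerset.1 hS)) (by positivity)

theorem bernoulliMean_const_mul (A : Finset α) (c : ℝ) (F : Finset α → ℝ) :
    bernoulliMean p A (fun S => c * F S) = c * bernoulliMean p A F := by
  simp only [bernoulliMean, Finset.mul_sum]
  exact Finset.sum_congr rfl fun S _ => by ring

theorem bernoulliMean_sum {ι : Type*} (A : Finset α) (s : Finset ι) (F : ι → Finset α → ℝ) :
    bernoulliMean p A (fun S => ∑ i ∈ s, F i S) = ∑ i ∈ s, bernoulliMean p A (F i) := by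
  simp only [bernoulliMean, Finset.mul_sum]
  exact Finset.sum_comm

theorem bernoulliMean_const (A : Finset α) (c : ℝ) : bernoulliMean p A (fun _ => c) = c := by
  have h := Finset.sum_pow_mul_eq_add_pow p (1 - p) A
  rw [add_sub_cancel, one_pow] at h
  rw [bernoulliMean, ← Finset.sum_mul, h, one_mul]

theorem bernoulliMean_insert [DecidableEq α] {A : Finset α} {a : α} (ha : a ∉ A)
    (F : Finset α → ℝ) :
    bernoulliMean p (insert a A) F =
      bernoulliMean p A fun S => (1 - p) * F S + p * F (insert a S) := by
  rw [bernoulliMean, Finset.sum_powerset_insert ha, ← Finset.sum_add_distrib]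
  refine Finset.sum_congr rfl fun S hS => ?_
  have hSA := mem_powerset.1 hS
  have haS : a ∉ S := fun h => ha (hSA h)
  have hc : #S ≤ #A := card_le_card hSA
  rw [card_insert_of_notMem ha, card_insert_of_notMem haS, Nat.add_sub_add_right,
    Nat.sub_add_comm hc]
  ring

/-- One step of the method of bounded differences: the exponential moment of a variable with two
values at distance at most `c ≤ 1`, from `exp x ≤ 1 + x + x ^ 2`. -/
theorem two_point_exp_le (hp : 0 ≤ p) (hp' : p ≤ 1) {u v c : ℝ} (hc : c ≤ 1) (h : |v - u| ≤ c) :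
    (1 - p) * Real.exp u + p * Real.exp v ≤ Real.exp ((1 - p) * u + p * v + c ^ 2) := by
  have h0 : |v - u| ≤ 1 := h.trans hc
  have hq : 0 ≤ 1 - p := by linarith
  have key : ∀ x : ℝ, |x| ≤ 1 → Real.exp x ≤ 1 + x + x ^ 2 := fun x hx => by
    have := (abs_le.1 (Real.abs_exp_sub_one_sub_id_le hx)).2
    linarith
  have h1 := key (-(p * (v - u))) (by
    rw [abs_neg, abs_mul, abs_of_nonneg hp]; exact mul_le_one₀ hp' (abs_nonneg _) h0)
  have h2 := key ((1 - p) * (v - u)) (by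
    rw [abs_mul, abs_of_nonneg hq]; exact mul_le_one₀ (by linarith) (abs_nonneg _) h0)
  have hsq : (v - u) ^ 2 ≤ c ^ 2 := sq_le_sq' (by linarith [(abs_le.1 h).1]) (abs_le.1 h).2
  set μ := (1 - p) * u + p * v with hμ
  have hu : Real.exp u = Real.exp μ * Real.exp (-(p * (v - u))) := by
    rw [← Real.exp_add]; congr 1; rw [hμ]; ring
  have hv : Real.exp v = Real.exp μ * Real.exp ((1 - p) * (v - u)) := by
    rw [← Real.exp_add]; congr 1; rw [hμ]; ring
  have h3 : (1 - p) * Real.exp (-(p * (v - u))) + p * Real.exp ((1 - p) * (v - u)) ≤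
      Real.exp (c ^ 2) := by
    have h4 := mul_le_mul_of_nonneg_left h1 hq
    have h5 := mul_le_mul_of_nonneg_left h2 hp
    have h6 : p * (1 - p) * (v - u) ^ 2 ≤ (v - u) ^ 2 :=
      mul_le_of_le_one_left (sq_nonneg _) (by nlinarith)
    have h7 := Real.add_one_le_exp (c ^ 2)
    nlinarith
  rw [hu, hv, Real.exp_add μ]
  calc _ = Real.exp μ * ((1 - p) * Real.exp (-(p * (v - u))) +
        p * Real.exp ((1 - p) * (v - u))) := by ring
    _ ≤ _ := mul_le_mul_of_nonneg_left h3 (Real.exp_pos _).le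

/-- The method of bounded differences (McDiarmid), in its exponential moment form. The induction
averages over one element of `A` at a time, which preserves the Lipschitz constant. -/
theorem bernoulliMean_exp_le [DecidableEq α] (hp : 0 ≤ p) (hp' : p ≤ 1) {c : ℝ} (hc : c ≤ 1)
    (A : Finset α) (F : Finset α → ℝ) (hF : ∀ a S, |F (insert a S) - F S| ≤ c) :
    bernoulliMean p A (fun S => Real.exp (F S)) ≤
      Real.exp (bernoulliMean p A F + #A * c ^ 2) := by
  induction A using Finset.induction_on generalizing F with
  | empty => simp [bernoulliMean]
  | insert a A ha ih =>
    rw [bernoulliMean_insert ha, bernoulliMean_insert ha, card_insert_of_notMem ha]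
    have hq : 0 ≤ 1 - p := by linarith
    have hF' : ∀ b S, |((1 - p) * F (insert b S) + p * F (insert a (insert b S))) -
        ((1 - p) * F S + p * F (insert a S))| ≤ c := fun b S => by
      have h1 := abs_le.1 (hF b S)
      have h2 := abs_le.1 (hF b (insert a S))
      rw [Finset.insert_comm] at h2
      rw [abs_le]
      constructor <;> nlinarith [mul_le_mul_of_nonneg_left h1.1 hq,
        mul_le_mul_of_nonneg_left h1.2 hq, mul_le_mul_of_nonneg_left h2.1 hp,
        mul_le_mul_of_nonneg_left h2.2 hp]
    have h3 := ih (fun S => (1 - p) * F S + p * F (insert a S)) hF'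
    calc _ ≤ bernoulliMean p A fun S =>
          Real.exp (c ^ 2) * Real.exp ((1 - p) * F S + p * F (insert a S)) := by
          refine bernoulliMean_mono hp hp' A fun S _ => ?_
          rw [← Real.exp_add, add_comm (c ^ 2)]
          exact two_point_exp_le hp hp' hc (hF a S)
      _ ≤ _ := by
          rw [bernoulliMean_const_mul]
          refine (mul_le_mul_of_nonneg_left h3 (Real.exp_pos _).le).trans_eq ?_
          rw [← Real.exp_add]
          congr 1
          push_cast
          ring

open Classical in
/-- A Chernoff bound: a set `Z` is unlikely to have at least half of its elements outside of `S`. -/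
theorem bernoulliMean_minority_le [Fintype α] (hp : 0 ≤ p) (hp' : p ≤ 1) {y : ℝ} (hy : 1 ≤ y)
    (Z : Finset α) :
    bernoulliMean p univ (fun S => if #(Z ∩ S) ≤ #(Z \ S) then 1 else 0) ≤
      (p / y + (1 - p) * y) ^ #Z := by
  have hy0 : 0 < y := by linarith
  have hprod : ∀ S : Finset α, p ^ #S * (1 - p) ^ (#(univ : Finset α) - #S) *
        (y⁻¹ ^ #(Z ∩ S) * y ^ #(Z \ S)) =
      (∏ a ∈ S, p * (if a ∈ Z then y⁻¹ else 1)) *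
        ∏ a ∈ univ \ S, (1 - p) * (if a ∈ Z then y else 1) := fun S => by
    rw [Finset.prod_mul_distrib, Finset.prod_mul_distrib, Finset.prod_const, Finset.prod_const,
      ← Finset.prod_filter, ← Finset.prod_filter, Finset.prod_const, Finset.prod_const,
      Finset.card_sdiff_of_subset (Finset.subset_univ S), Finset.filter_mem_eq_inter,
      Finset.filter_mem_eq_inter, Finset.inter_comm S Z]
    have : (univ \ S) ∩ Z = Z \ S := by ext; simp [and_comm]
    rw [this]
    ring
  calc _ ≤ bernoulliMean p univ (fun S => y⁻¹ ^ #(Z ∩ S) * y ^ #(Z \ S)) := by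
        refine bernoulliMean_mono hp hp' _ fun S _ => ?_
        split_ifs with h
        · rw [inv_pow, inv_mul_eq_div, one_le_div (by positivity)]
          exact pow_le_pow_right₀ hy h
        · positivity
    _ = ∏ a : α, (p * (if a ∈ Z then y⁻¹ else 1) + (1 - p) * (if a ∈ Z then y else 1)) := by
        rw [Finset.prod_add, bernoulliMean]
        exact Finset.sum_congr rfl fun S _ => hprod S
    _ = ∏ a ∈ Z, (p / y + (1 - p) * y) := by
        rw [← Finset.prod_subset (Finset.subset_univ Z)]
        · exact Finset.prod_congr rfl fun a ha => by simp [ha, div_eq_mul_inv]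
        · intro a _ ha
          simp [ha]
    _ = _ := by rw [Finset.prod_const]

/-- The term `j = a` of the binomial expansion of `(a + b) ^ (a + b)` is the largest one. -/
theorem binomial_term_le (a b j : ℕ) (hj : j ≤ a + b) :
    a ^ j * b ^ (a + b - j) * (a + b).choose j ≤ a ^ a * b ^ b * (a + b).choose a := by
  rcases Nat.eq_zero_or_pos b with rfl | hb
  · rcases hj.lt_or_eq with h | h
    · have : a - j ≠ 0 := by omega
      simp [this]
    · obtain rfl : j = a := h
      simp
  set t : ℕ → ℕ := fun j => a ^ j * b ^ (a + b - j) * (a + b).choose j with ht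
  have hta : a ^ a * b ^ b * (a + b).choose a = t a := by simp [ht]
  have hrec : ∀ i < a + b, (i + 1) * b * t (i + 1) = (a + b - i) * a * t i := fun i hi => by
    have h1 := Nat.choose_succ_right_eq (a + b) i
    have h2 : b ^ (a + b - i) = b ^ (a + b - (i + 1)) * b := by
      rw [← pow_succ]; congr 1; omega
    simp only [ht, h2, pow_succ a i]
    calc _ = a ^ i * a * b ^ (a + b - (i + 1)) * b * ((a + b).choose (i + 1) * (i + 1)) := by ring
      _ = _ := by rw [h1]; ring
  have hup : ∀ i < a, t i ≤ t (i + 1) := fun i hi => by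
    refine (Nat.mul_le_mul_left_iff (Nat.mul_pos i.succ_pos hb)).1 ?_
    rw [hrec i (by omega)]
    refine Nat.mul_le_mul_right _ ?_
    rw [mul_comm (a + b - i) a]
    exact Nat.mul_le_mul hi (by omega)
  have hdown : ∀ i, a ≤ i → i < a + b → t (i + 1) ≤ t i := fun i hi hi' => by
    refine (Nat.mul_le_mul_left_iff (Nat.mul_pos i.succ_pos hb)).1 ?_
    rw [hrec i hi']
    refine Nat.mul_le_mul_right _ ?_
    rw [mul_comm (a + b - i) a]
    exact Nat.mul_le_mul (by omega) (by omega)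
  rw [hta]
  change t j ≤ t a
  rcases le_total j a with h | h
  · exact Nat.le_induction (m := j) (P := fun i _ => i ≤ a → t j ≤ t i) (fun _ => le_rfl)
      (fun i _ ih hi' => (ih (by omega)).trans (hup i hi')) a h le_rfl
  · exact Nat.le_induction (m := a) (P := fun i _ => i ≤ a + b → t i ≤ t a) (fun _ => le_rfl)
      (fun i hi ih hi' => (hdown i hi hi').trans (ih (by omega))) j h hj

theorem add_pow_le_card_mul_choose (a b : ℕ) :
    (a + b) ^ (a + b) ≤ (a + b + 1) * (a ^ a * b ^ b * (a + b).choose a) := by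
  rw [add_pow]
  refine (Finset.sum_le_card_nsmul _ _ _ fun j hj =>
    binomial_term_le a b j (by simpa [Nat.lt_succ_iff] using hj)).trans_eq ?_
  simp

open Classical in
/-- A uniformly random `M`-set is a random set with density `M / L` (where `L` is the size of the
ground set) conditioned on having its most likely size, an event of probability at least
`1 / (L + 1)`. -/
theorem uniformProb_powersetCard_le [Fintype α] (M : ℕ) (hM : M ≤ Fintype.card α)
    (hL : 0 < Fintype.card α) (E : Finset α → Prop) :
    uniformProb (powersetCard M (univ : Finset α)) E ≤ (Fintype.card α + 1) *
      bernoulliMean ((M : ℝ) / Fintype.card α) univ (fun S => if E S then 1 else 0) := by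
  obtain ⟨b, hb⟩ := Nat.exists_eq_add_of_le hM
  set L := Fintype.card α with hLdef
  have hL' : (0 : ℝ) < L := by exact_mod_cast hL
  set p : ℝ := (M : ℝ) / L with hp
  have hq : 1 - p = (b : ℝ) / L := by
    rw [hp, eq_div_iff hL'.ne', sub_mul, div_mul_cancel₀ _ hL'.ne', hb]; push_cast; ring
  have hp0 : 0 ≤ p := by positivity
  have hq0 : 0 ≤ 1 - p := by rw [hq]; positivity
  set ω : ℝ := p ^ M * (1 - p) ^ (L - M) with hω
  have hLM : L - M = b := by omega
  have hmode : 1 ≤ (L + 1) * (ω * L.choose M) := by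
    have h := add_pow_le_card_mul_choose M b
    rw [← hb] at h
    have h' : (L : ℝ) ^ L ≤ (L + 1) * (M ^ M * b ^ b * L.choose M) := by exact_mod_cast h
    rw [hω, hq, hLM, hp, div_pow, div_pow, div_mul_div_comm, ← pow_add, ← hb, div_mul_eq_mul_div,
      mul_div_assoc', one_le_div (by positivity)]
    exact h'
  have hch : (0 : ℝ) < L.choose M := by exact_mod_cast Nat.choose_pos hM
  have hsum : ω * #((powersetCard M (univ : Finset α)).filter E) ≤
      bernoulliMean p univ (fun S => if E S then 1 else 0) := by
    rw [bernoulliMean, card_univ, ← hLdef]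
    calc _ = ∑ S ∈ (powersetCard M (univ : Finset α)).filter E,
          p ^ #S * (1 - p) ^ (L - #S) * (if E S then 1 else 0) := by
          rw [mul_comm, ← nsmul_eq_mul, ← Finset.sum_const]
          refine Finset.sum_congr rfl fun S hS => ?_
          rw [mem_filter, mem_powersetCard] at hS
          rw [if_pos hS.2, hS.1.2, mul_one]
      _ ≤ _ := by
          refine Finset.sum_le_sum_of_subset_of_nonneg (fun S _ => by simp) fun S _ _ => ?_
          split_ifs <;> positivity
  rw [uniformProb, card_powersetCard, card_univ, ← hLdef, div_le_iff₀ hch]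
  set f : ℝ := (#((powersetCard M (univ : Finset α)).filter E) : ℝ)
  have hf : 0 ≤ f := Nat.cast_nonneg _
  calc f ≤ f * ((L + 1) * (ω * L.choose M)) := le_mul_of_one_le_right hf hmode
    _ = (L + 1) * (ω * f) * L.choose M := by ring
    _ ≤ _ := by gcongr

end bernoulliMean

/-! ### Functions of low degree over the field with two elements -/

/-- The affine coordinate of `x` named by `o`: one of its entries, or the constant `1`. -/
def affineCoord {ι : Type*} (x : ι → ZMod 2) (o : Option ι) : ZMod 2 :=
  o.elim 1 x

/-- The polynomial function with coefficients `a`. Its monomials are the products, indexed by `E`,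
of affine coordinates, so that these functions are those of degree at most the size of `E`. -/
def lowDegree {ι E : Type*} [Fintype ι] [DecidableEq E] [Fintype E] (a : (E → Option ι) → ZMod 2)
    (x : ι → ZMod 2) : ZMod 2 :=
  ∑ u, a u * ∏ e, affineCoord x (u e)

section lowDegree

variable {ι E : Type*} [Fintype ι] [DecidableEq E] [Fintype E]

theorem lowDegree_sum {κ : Type*} (s : Finset κ) (a : κ → (E → Option ι) → ZMod 2)
    (x : ι → ZMod 2) : lowDegree (fun u => ∑ i ∈ s, a i u) x = ∑ i ∈ s, lowDegree (a i) x := by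
  simp only [lowDegree, Finset.sum_mul]
  exact Finset.sum_comm

theorem lowDegree_add (a b : (E → Option ι) → ZMod 2) (x : ι → ZMod 2) :
    lowDegree (a + b) x = lowDegree a x + lowDegree b x := by
  simp [lowDegree, add_mul, Finset.sum_add_distrib]

theorem prod_affine_eq_lowDegree (c : E → Option ι → ZMod 2) (x : ι → ZMod 2) :
    ∏ e, (∑ o, c e o * affineCoord x o) = lowDegree (fun u => ∏ e, c e (u e)) x := by
  classical
  simp only [lowDegree, Finset.prod_univ_sum, Fintype.piFinset_univ, Finset.prod_mul_distrib]

/-- A product of fewer than `r` affine functions of `t` sums to zero over the `r`-dimensional space: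
a monomial that does not involve the coordinate `j` is invariant under flipping `t j`. -/
theorem sum_prod_affine_eq_zero {κ : Type*} [Fintype κ] [DecidableEq κ]
    (h : Fintype.card E < Fintype.card κ) (c : E → Option κ → ZMod 2) :
    ∑ t : κ → ZMod 2, ∏ e, (∑ o, c e o * affineCoord t o) = 0 := by
  simp only [prod_affine_eq_lowDegree, lowDegree]
  rw [Finset.sum_comm]
  refine Finset.sum_eq_zero fun u _ => ?_
  rw [← Finset.mul_sum]
  have hj : ∃ j : κ, ∀ e, u e ≠ some j := by
    by_contra! hcon
    choose f hf using hcon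
    have hinj : Function.Injective f := fun i j hij => by
      have := hf i
      rw [hij, hf j] at this
      exact (Option.some.inj this).symm
    exact absurd (Fintype.card_le_of_injective f hinj) (not_le.2 h)
  obtain ⟨j, hj⟩ := hj
  have hinv : ∀ t : κ → ZMod 2, ∏ e, affineCoord (t + Pi.single j 1) (u e) =
      ∏ e, affineCoord t (u e) := fun t => by
    refine Finset.prod_congr rfl fun e _ => ?_
    cases hu : u e with
    | none => rfl
    | some i =>
      have hij : i ≠ j := fun h => hj e (by rw [hu, h])
      simp [affineCoord, hij]
  have hsum : ∑ t : κ → ZMod 2, ∏ e, affineCoord t (u e) = 0 := by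
    refine Finset.sum_involution (fun t _ => t + Pi.single j 1) ?_ ?_ ?_ ?_
    · intro t _
      rw [hinv, CharTwo.add_self_eq_zero]
    · intro t _ _ h
      have := congrFun h j
      simp at this
    · simp
    · intro t _
      rw [add_assoc, ← Pi.single_add, CharTwo.add_self_eq_zero]
      simp
  rw [hsum, mul_zero]

/-- The pullback of a low degree function along a linear map sums to zero over a space of larger
dimension. -/
theorem sum_lowDegree_comp_eq_zero {κ : Type*} [Fintype κ] [DecidableEq κ]
    (h : Fintype.card E < Fintype.card κ) (a : (E → Option ι) → ZMod 2) (w : κ → ι → ZMod 2) :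
    ∑ t : κ → ZMod 2, lowDegree a (∑ j, t j • w j) = 0 := by
  simp only [lowDegree]
  rw [Finset.sum_comm]
  refine Finset.sum_eq_zero fun u _ => ?_
  rw [← Finset.mul_sum]
  have := sum_prod_affine_eq_zero h (fun e o => match u e, o with
    | none, none => 1
    | none, some _ => 0
    | some _, none => 0
    | some i, some j => w j i)
  convert mul_zero _
  rw [← this]
  refine Finset.sum_congr rfl fun t _ => Finset.prod_congr rfl fun e _ => ?_
  cases u e with
  | none => simp [affineCoord, Fintype.sum_option]
  | some i => simp [affineCoord, Fintype.sum_option, mul_comm]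

/-- If `t ≠ 0` then the combination of uniformly random vectors with coefficients `t` is
uniformly distributed. -/
theorem card_filter_combination {κ V : Type*} [Fintype κ] [DecidableEq κ] [AddCommGroup V]
    [Module (ZMod 2) V] [Fintype V] [DecidableEq V] {t : κ → ZMod 2} (ht : t ≠ 0) (b : V) :
    #{w : κ → V | ∑ j, t j • w j = b} * Fintype.card V = Fintype.card (κ → V) := by
  obtain ⟨j, hj⟩ := Function.ne_iff.1 ht
  have hj1 : t j = 1 := by
    have h2 : ∀ z : ZMod 2, z ≠ 0 → z = 1 := by decide
    exact h2 _ hj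
  have hshift : ∀ (w : κ → V) (d : V),
      ∑ i, t i • (w + Pi.single j d : κ → V) i = ∑ i, t i • w i + d := fun w d => by
    simp only [Pi.add_apply, smul_add, Finset.sum_add_distrib]
    rw [Finset.sum_eq_single j (f := fun i => t i • (Pi.single j d : κ → V) i)]
    · simp [hj1]
    · intro i _ hi
      simp [hi]
    · simp
  have hcard : ∀ b' : V, #{w : κ → V | ∑ j, t j • w j = b'} =
      #{w : κ → V | ∑ j, t j • w j = b} := fun b' => by
    refine Finset.card_bij' (fun w _ => w + Pi.single j (b - b'))
      (fun w _ => w + Pi.single j (b' - b)) ?_ ?_ ?_ ?_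
    · intro w hw
      simp only [mem_filter, mem_univ, true_and] at hw ⊢
      rw [hshift, hw, add_sub_cancel]
    · intro w hw
      simp only [mem_filter, mem_univ, true_and] at hw ⊢
      rw [hshift, hw, add_sub_cancel]
    · intro w _
      rw [add_assoc, ← Pi.single_add]
      simp
    · intro w _
      rw [add_assoc, ← Pi.single_add]
      simp
  have := Finset.card_eq_sum_card_fiberwise (f := fun w : κ → V => ∑ j, t j • w j)
    (s := univ) (t := univ) (fun _ _ => by simp)
  rw [← card_univ (α := κ → V), this, Finset.sum_congr rfl fun b' _ => hcard b']
  simp [mul_comm]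

open Classical in
/-- The minimum distance of Reed-Muller codes, up to a factor of `2`. A random linear image of the
space of dimension `|E| + 1` contains a nonzero vector where `lowDegree a` does not vanish, and each
nonzero combination is uniformly distributed. -/
theorem card_le_card_support_lowDegree (a : (E → Option ι) → ZMod 2) (h0 : lowDegree a 0 = 1) :
    2 ^ Fintype.card ι ≤ 2 ^ (Fintype.card E + 1) * #{x | lowDegree a x = 1} := by
  set κ := Fin (Fintype.card E + 1)
  set V := ι → ZMod 2
  set Z : Finset V := {x | lowDegree a x = 1} with hZ
  have hcov : (univ : Finset (κ → V)) ⊆ (univ.filter fun t : κ → ZMod 2 => t ≠ 0).biUnion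
      fun t => {w : κ → V | ∑ j, t j • w j ∈ Z} := fun w _ => by
    by_contra hcon
    simp only [mem_biUnion, mem_filter, mem_univ, true_and, not_exists, not_and, hZ] at hcon
    have hsum := sum_lowDegree_comp_eq_zero (κ := κ) (by simp [κ]) a w
    rw [Finset.sum_eq_single (0 : κ → ZMod 2)] at hsum
    · simp [h0] at hsum
    · intro t _ ht
      have h2 : ∀ z : ZMod 2, z ≠ 1 → z = 0 := by decide
      exact h2 _ (hcon t ht)
    · simp
  have hpart : ∀ t : κ → ZMod 2, t ≠ 0 →
      #{w : κ → V | ∑ j, t j • w j ∈ Z} * Fintype.card V = #Z * Fintype.card (κ → V) :=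
    fun t ht => by
    have : ({w : κ → V | ∑ j, t j • w j ∈ Z} : Finset (κ → V)) =
        Z.biUnion fun b => {w : κ → V | ∑ j, t j • w j = b} := by ext w; simp
    rw [this, Finset.card_biUnion, Finset.sum_mul, Finset.sum_congr rfl fun b _ =>
      card_filter_combination ht b, Finset.sum_const, smul_eq_mul]
    intro b _ b' _ hbb'
    rw [Function.onFun, Finset.disjoint_filter]
    intro w _ h1 h2
    exact hbb' (h1.symm.trans h2)
  have hle := (Finset.card_le_card hcov).trans Finset.card_biUnion_le
  have hle' := Nat.mul_le_mul_right (Fintype.card V) hle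
  rw [Finset.sum_mul, Finset.sum_congr rfl fun t ht => hpart t (mem_filter.1 ht).2,
    Finset.sum_const, smul_eq_mul, card_univ] at hle'
  have hpos : 0 < Fintype.card (κ → V) := Fintype.card_pos
  have hle2 : Fintype.card (κ → V) * Fintype.card V ≤ Fintype.card (κ → V) *
      (#(univ.filter fun t : κ → ZMod 2 => t ≠ 0) * #Z) := by
    calc _ ≤ _ := hle'
      _ = _ := by ring
  have hle3 := le_of_mul_le_mul_left hle2 hpos
  have hV : Fintype.card V = 2 ^ Fintype.card ι := by simp [V, ZMod.card]
  have hT : #(univ.filter fun t : κ → ZMod 2 => t ≠ 0) ≤ 2 ^ (Fintype.card E + 1) := by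
    refine (Finset.card_filter_le _ _).trans ?_
    simp [κ, ZMod.card]
  rw [hV] at hle3
  exact hle3.trans (Nat.mul_le_mul_right _ hT)

end lowDegree

/-! ### Decoding on a random subspace -/

/-- A set `R` of points of `𝔽₂ ^ m` is *reliable* if each low degree function that is nonzero at
the origin has more nonzero values at points of `R` than outside of `R`, the origin not counted. -/
def IsReliable (E : Type*) [DecidableEq E] [Fintype E] {m : ℕ}
    (R : Finset (Fin m → ZMod 2)) : Prop :=
  ∀ a : (E → Option (Fin m)) → ZMod 2, lowDegree a 0 = 1 →
    #{x | (x ≠ 0 ∧ lowDegree a x = 1) ∧ x ∉ R} < #{x | (x ≠ 0 ∧ lowDegree a x = 1) ∧ x ∈ R}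

open Classical in
/-- The value at the origin of a low degree function that agrees with `y` on a reliable set: `1` if
there is such a function with the value `1`, and `0` otherwise. -/
noncomputable def decode (E : Type*) [DecidableEq E] [Fintype E] {m : ℕ}
    (y : (Fin m → ZMod 2) → ZMod 2) : ZMod 2 :=
  if ∃ (a : (E → Option (Fin m)) → ZMod 2) (R : Finset (Fin m → ZMod 2)),
    IsReliable E R ∧ (∀ x ∈ R, x ≠ 0 → y x = lowDegree a x) ∧ lowDegree a 0 = 1 then 1 else 0

section decode

variable {E : Type*} [DecidableEq E] [Fintype E] {m : ℕ}

theorem isReliable_congr {R R' : Finset (Fin m → ZMod 2)}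
    (h : ∀ x ≠ 0, (x ∈ R ↔ x ∈ R')) : IsReliable E R ↔ IsReliable E R' := by
  refine forall₂_congr fun a _ => ?_
  have h1 : ∀ x : Fin m → ZMod 2, ((x ≠ 0 ∧ lowDegree a x = 1) ∧ x ∉ R) ↔
      ((x ≠ 0 ∧ lowDegree a x = 1) ∧ x ∉ R') := fun x =>
    and_congr_right fun hx => not_congr (h x hx.1)
  have h2 : ∀ x : Fin m → ZMod 2, ((x ≠ 0 ∧ lowDegree a x = 1) ∧ x ∈ R) ↔
      ((x ≠ 0 ∧ lowDegree a x = 1) ∧ x ∈ R') := fun x =>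
    and_congr_right fun hx => h x hx.1
  rw [Finset.filter_congr fun x _ => h1 x, Finset.filter_congr fun x _ => h2 x]

/-- Two reliable sets that determine different values cannot exist: each of them would contain the
majority of the points where the two low degree functions differ. -/
theorem decode_eq {y : (Fin m → ZMod 2) → ZMod 2} {b : (E → Option (Fin m)) → ZMod 2}
    {R : Finset (Fin m → ZMod 2)} (hR : IsReliable E R)
    (hy : ∀ x ∈ R, x ≠ 0 → y x = lowDegree b x) : decode E y = lowDegree b 0 := by
  have h2 : ∀ z : ZMod 2, z ≠ 1 → z = 0 := by decide
  rw [decode]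
  split_ifs with h
  · obtain ⟨a, R', hR', hy', ha⟩ := h
    by_contra hb
    have hb0 : lowDegree b 0 = 0 := h2 _ (Ne.symm hb)
    have hab : lowDegree (a + b) 0 = 1 := by rw [lowDegree_add, ha, hb0, add_zero]
    have h1 := hR _ hab
    have h1' := hR' _ hab
    have hsub : ({x | (x ≠ 0 ∧ lowDegree (a + b) x = 1) ∧ x ∈ R} : Finset (Fin m → ZMod 2)) ⊆
        ({x | (x ≠ 0 ∧ lowDegree (a + b) x = 1) ∧ x ∉ R'} : Finset (Fin m → ZMod 2)) := by
      intro x hx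
      simp only [mem_filter, mem_univ, true_and] at hx ⊢
      refine ⟨hx.1, fun hxR' => ?_⟩
      have : lowDegree (a + b) x = 0 := by
        rw [lowDegree_add, ← hy x hx.2 hx.1.1, ← hy' x hxR' hx.1.1, CharTwo.add_self_eq_zero]
      simp [this] at hx
    have hsub' : ({x | (x ≠ 0 ∧ lowDegree (a + b) x = 1) ∧ x ∈ R'} : Finset (Fin m → ZMod 2)) ⊆
        ({x | (x ≠ 0 ∧ lowDegree (a + b) x = 1) ∧ x ∉ R} : Finset (Fin m → ZMod 2)) := by
      intro x hx
      simp only [mem_filter, mem_univ, true_and] at hx ⊢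
      refine ⟨hx.1, fun hxR => ?_⟩
      have : lowDegree (a + b) x = 0 := by
        rw [lowDegree_add, ← hy x hxR hx.1.1, ← hy' x hx.2 hx.1.1, CharTwo.add_self_eq_zero]
      simp [this] at hx
    have := card_le_card hsub
    have := card_le_card hsub'
    omega
  · by_contra hb
    exact h ⟨b, R, hR, hy, by_contra fun h1 => hb (h2 _ h1).symm⟩

end decode

section failure

variable {E : Type*} [DecidableEq E] [Fintype E] {m : ℕ} {V α : Type*} [AddCommGroup V]
  [Module (ZMod 2) V] [Fintype V] [DecidableEq V]

/-- The point with coordinates `x` of the affine space through `g` with directions `w`, transported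
to `α`. -/
def subspacePoint (φ : V ≃ α) (g : V) (w : Fin m → V) (x : Fin m → ZMod 2) : α :=
  φ (g + ∑ j, x j • w j)

open Classical in
/-- The proportion of directions `w` for which the points in `S` of the affine space through `g` do
not form a reliable set. -/
noncomputable def failureRate (E : Type*) [DecidableEq E] [Fintype E] (m : ℕ) (φ : V ≃ α) (g : V)
    (S : Finset α) : ℝ :=
  (#{w : Fin m → V | ¬ IsReliable E (univ.filter fun x => subspacePoint φ g w x ∈ S)} : ℝ) /
    Fintype.card (Fin m → V)

theorem card_filter_subspacePoint [DecidableEq α] (φ : V ≃ α) (g : V) {x : Fin m → ZMod 2}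
    (hx : x ≠ 0) (b : α) :
    (#{w : Fin m → V | subspacePoint φ g w x = b} : ℝ) =
      Fintype.card (Fin m → V) / Fintype.card V := by
  have h := card_filter_combination hx (φ.symm b - g)
  have h0 : (Fintype.card V : ℝ) ≠ 0 := by exact_mod_cast Fintype.card_ne_zero
  rw [eq_div_iff h0]
  have : ({w : Fin m → V | subspacePoint φ g w x = b} : Finset (Fin m → V)) =
      ({w : Fin m → V | ∑ j, x j • w j = φ.symm b - g} : Finset (Fin m → V)) := by
    ext w
    simp only [mem_filter, mem_univ, true_and]
    rw [subspacePoint, ← Equiv.eq_symm_apply, eq_sub_iff_add_eq, add_comm]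
  rw [this]
  exact_mod_cast h

theorem card_filter_subspacePoint_exists_le [DecidableEq α] (φ : V ≃ α) (g : V) (b : α) :
    (#{w : Fin m → V | ∃ x, x ≠ 0 ∧ subspacePoint φ g w x = b} : ℝ) ≤
      2 ^ m * (Fintype.card (Fin m → V) / Fintype.card V) := by
  have hsub : ({w : Fin m → V | ∃ x, x ≠ 0 ∧ subspacePoint φ g w x = b} : Finset (Fin m → V)) ⊆
      (univ.filter fun x : Fin m → ZMod 2 => x ≠ 0).biUnion
        fun x => {w : Fin m → V | subspacePoint φ g w x = b} := by
    intro w; simp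
  have h1 := (card_le_card hsub).trans card_biUnion_le
  have h2 : (#{w : Fin m → V | ∃ x, x ≠ 0 ∧ subspacePoint φ g w x = b} : ℝ) ≤
      ∑ x : Fin m → ZMod 2 with x ≠ 0, (#{w : Fin m → V | subspacePoint φ g w x = b} : ℝ) := by
    exact_mod_cast h1
  refine h2.trans ?_
  rw [Finset.sum_congr rfl fun x hx => card_filter_subspacePoint φ g (mem_filter.1 hx).2 b,
    Finset.sum_const, nsmul_eq_mul]
  refine mul_le_mul_of_nonneg_right ?_ (by positivity)
  have := Finset.card_filter_le (univ : Finset (Fin m → ZMod 2)) fun x => x ≠ 0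
  have h3 : #(univ : Finset (Fin m → ZMod 2)) = 2 ^ m := by simp [ZMod.card]
  rw [h3] at this
  exact_mod_cast this

open Classical in
theorem card_filter_not_injective_le (φ : V ≃ α) (g : V) :
    (#{w : Fin m → V | ¬ Function.Injective (subspacePoint φ g w)} : ℝ) ≤
      2 ^ m * (Fintype.card (Fin m → V) / Fintype.card V) := by
  refine le_trans ?_ (card_filter_subspacePoint_exists_le φ g (φ g))
  refine Nat.cast_le.2 (card_le_card fun w hw => ?_)
  simp only [mem_filter, mem_univ, true_and, Function.Injective, not_forall] at hw ⊢
  obtain ⟨x, x', h, hne⟩ := hw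
  refine ⟨x - x', sub_ne_zero.2 hne, ?_⟩
  simp only [subspacePoint, EmbeddingLike.apply_eq_iff_eq, add_right_inj, Pi.sub_apply, sub_smul,
    Finset.sum_sub_distrib] at h ⊢
  rw [h, sub_self, add_zero]

open Classical in
theorem abs_failureRate_insert_sub_le (φ : V ≃ α) (g : V) (b : α)
    (S : Finset α) :
    |failureRate E m φ g (insert b S) - failureRate E m φ g S| ≤ 2 ^ m / Fintype.card V := by
  have hW : (0 : ℝ) < Fintype.card (Fin m → V) := by exact_mod_cast Fintype.card_pos
  set T : Finset (Fin m → V) := {w | ∃ x, x ≠ 0 ∧ subspacePoint φ g w x = b} with hT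
  set A : Finset α → Finset (Fin m → V) := fun S =>
    {w | ¬ IsReliable E (univ.filter fun x => subspacePoint φ g w x ∈ S)} with hA
  have hiff : ∀ w ∉ T, (w ∈ A (insert b S) ↔ w ∈ A S) := fun w hw => by
    simp only [hT, mem_filter, mem_univ, true_and, not_exists, not_and] at hw
    simp only [hA, mem_filter, mem_univ, true_and]
    rw [not_iff_not]
    refine isReliable_congr fun x hx => ?_
    simp only [mem_filter, mem_univ, true_and, mem_insert]
    exact or_iff_right (hw x hx)
  have hTc : (#T : ℝ) / Fintype.card (Fin m → V) ≤ 2 ^ m / Fintype.card V := by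
    rw [div_le_iff₀ hW]
    exact (card_filter_subspacePoint_exists_le (m := m) φ g b).trans_eq (by ring)
  have hle : ∀ B C : Finset (Fin m → V), (∀ w ∉ T, w ∈ B → w ∈ C) →
      (#B : ℝ) ≤ #C + #T := fun B C h => by
    have : B ⊆ C ∪ T := fun w hw => by
      by_cases hwT : w ∈ T
      · exact mem_union_right _ hwT
      · exact mem_union_left _ (h w hwT hw)
    exact_mod_cast (card_le_card this).trans (card_union_le _ _)
  refine le_trans ?_ hTc
  change |(#(A (insert b S)) : ℝ) / _ - (#(A S) : ℝ) / _| ≤ _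
  rw [← sub_div, abs_div, abs_of_pos hW]
  refine div_le_div_of_nonneg_right ?_ hW.le
  rw [abs_le]
  constructor
  · linarith [hle (A S) (A (insert b S)) fun w hw => (hiff w hw).2]
  · linarith [hle (A (insert b S)) (A S) fun w hw => (hiff w hw).1]

variable [Fintype α]

open Classical in
/-- On an affine space with distinct points, a pattern that is not reliable is caused by one of the
low degree functions, and each of them has a large support. -/
theorem bernoulliMean_failureRate_le {p : ℝ} (hp : 0 ≤ p) (hp' : p ≤ 1) {y : ℝ} (hy : 1 ≤ y)
    (hθ : p / y + (1 - p) * y ≤ 1) (r : ℕ)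
    (hr : ∀ a : (E → Option (Fin m)) → ZMod 2, lowDegree a 0 = 1 →
      r ≤ #{x | x ≠ 0 ∧ lowDegree a x = 1})
    (φ : V ≃ α) (g : V) :
    bernoulliMean p univ (failureRate E m φ g) ≤ 2 ^ m / Fintype.card V +
      Fintype.card ((E → Option (Fin m)) → ZMod 2) * (p / y + (1 - p) * y) ^ r := by
  have hW : (0 : ℝ) < Fintype.card (Fin m → V) := by exact_mod_cast Fintype.card_pos
  set θ := p / y + (1 - p) * y with hθdef
  have hθ0 : 0 ≤ θ := by
    have : 0 ≤ 1 - p := by linarith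
    positivity
  set Z : (Fin m → V) → ((E → Option (Fin m)) → ZMod 2) → Finset α := fun w a =>
    ({x | x ≠ 0 ∧ lowDegree a x = 1} : Finset (Fin m → ZMod 2)).image (subspacePoint φ g w) with hZ
  set J : Finset (Fin m → V) := {w | ¬ Function.Injective (subspacePoint φ g w)} with hJ
  set C : Finset ((E → Option (Fin m)) → ZMod 2) := {a | lowDegree a 0 = 1} with hC
  have hpt : ∀ S : Finset α, failureRate E m φ g S ≤ (Fintype.card (Fin m → V) : ℝ)⁻¹ *
      ∑ w : Fin m → V, (if w ∈ J then 1 else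
        ∑ a ∈ C, if #(Z w a ∩ S) ≤ #(Z w a \ S) then (1 : ℝ) else 0) := fun S => by
    rw [failureRate, div_eq_inv_mul]
    refine mul_le_mul_of_nonneg_left ?_ (by positivity)
    rw [Finset.card_filter, Nat.cast_sum]
    refine Finset.sum_le_sum fun w _ => ?_
    have hnn : (0 : ℝ) ≤ ∑ a ∈ C, if #(Z w a ∩ S) ≤ #(Z w a \ S) then (1 : ℝ) else 0 :=
      Finset.sum_nonneg fun a _ => by split_ifs <;> norm_num
    by_cases hw : w ∈ J
    · rw [if_pos hw]
      split_ifs <;> norm_num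
    · rw [if_neg hw]
      have hinj : Function.Injective (subspacePoint φ g w) := by
        simpa [hJ] using hw
      split_ifs with hbad
      · rw [Nat.cast_zero]
        exact hnn
      · simp only [IsReliable, not_forall, not_lt] at hbad
        obtain ⟨a, ha, hle⟩ := hbad
        have h1 : #(Z w a ∩ S) ≤ #(Z w a \ S) := by
          have e1 : Z w a ∩ S = ({x | (x ≠ 0 ∧ lowDegree a x = 1) ∧
              x ∈ univ.filter fun x => subspacePoint φ g w x ∈ S} :
              Finset (Fin m → ZMod 2)).image (subspacePoint φ g w) := by
            ext b
            simp only [hZ, mem_inter, mem_image, mem_filter, mem_univ, true_and]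
            constructor
            · rintro ⟨⟨x, hx, rfl⟩, hS⟩
              exact ⟨x, ⟨hx, hS⟩, rfl⟩
            · rintro ⟨x, ⟨hx, hS⟩, rfl⟩
              exact ⟨⟨x, hx, rfl⟩, hS⟩
          have e2 : Z w a \ S = ({x | (x ≠ 0 ∧ lowDegree a x = 1) ∧
              x ∉ univ.filter fun x => subspacePoint φ g w x ∈ S} :
              Finset (Fin m → ZMod 2)).image (subspacePoint φ g w) := by
            ext b
            simp only [hZ, mem_sdiff, mem_image, mem_filter, mem_univ, true_and]
            constructor
            · rintro ⟨⟨x, hx, rfl⟩, hS⟩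
              exact ⟨x, ⟨hx, hS⟩, rfl⟩
            · rintro ⟨x, ⟨hx, hS⟩, rfl⟩
              exact ⟨⟨x, hx, rfl⟩, hS⟩
          rw [e1, e2, card_image_of_injective _ hinj, card_image_of_injective _ hinj]
          exact hle
        have haC : a ∈ C := by simpa [hC] using ha
        refine le_trans ?_ (Finset.single_le_sum (f := fun a =>
          if #(Z w a ∩ S) ≤ #(Z w a \ S) then (1 : ℝ) else 0)
          (fun a _ => by split_ifs <;> norm_num) haC)
        simp [h1]
  have hmean : ∀ w : Fin m → V, bernoulliMean p univ (fun S => if w ∈ J then (1 : ℝ) else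
      ∑ a ∈ C, if #(Z w a ∩ S) ≤ #(Z w a \ S) then (1 : ℝ) else 0) ≤
      (if w ∈ J then 1 else 0) + Fintype.card ((E → Option (Fin m)) → ZMod 2) * θ ^ r :=
    fun w => by
    have hnn : 0 ≤ Fintype.card ((E → Option (Fin m)) → ZMod 2) * θ ^ r := by positivity
    by_cases hw : w ∈ J
    · simp only [if_pos hw, bernoulliMean_const]
      linarith
    · simp only [if_neg hw, zero_add]
      have hinj : Function.Injective (subspacePoint φ g w) := by
        simpa [hJ] using hw
      rw [bernoulliMean_sum]
      calc _ ≤ ∑ a ∈ C, θ ^ r := by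
            refine Finset.sum_le_sum fun a ha => ?_
            refine (bernoulliMean_minority_le hp hp' hy (Z w a)).trans ?_
            refine pow_le_pow_of_le_one hθ0 hθ ?_
            simp only [hZ]
            rw [card_image_of_injective _ hinj]
            exact hr a (mem_filter.1 ha).2
        _ ≤ _ := by
            rw [Finset.sum_const, nsmul_eq_mul]
            refine mul_le_mul_of_nonneg_right ?_ (by positivity)
            exact_mod_cast card_le_univ C
  calc _ ≤ bernoulliMean p univ (fun S => (Fintype.card (Fin m → V) : ℝ)⁻¹ *
      ∑ w : Fin m → V, (if w ∈ J then 1 else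
        ∑ a ∈ C, if #(Z w a ∩ S) ≤ #(Z w a \ S) then (1 : ℝ) else 0)) :=
        bernoulliMean_mono hp hp' _ fun S _ => hpt S
    _ ≤ (Fintype.card (Fin m → V) : ℝ)⁻¹ * ∑ w : Fin m → V, ((if w ∈ J then 1 else 0) +
        Fintype.card ((E → Option (Fin m)) → ZMod 2) * θ ^ r) := by
        rw [bernoulliMean_const_mul, bernoulliMean_sum]
        exact mul_le_mul_of_nonneg_left (Finset.sum_le_sum fun w _ => hmean w) (by positivity)
    _ = (#J : ℝ) / Fintype.card (Fin m → V) +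
        Fintype.card ((E → Option (Fin m)) → ZMod 2) * θ ^ r := by
        rw [Finset.sum_add_distrib, Finset.sum_const, card_univ, nsmul_eq_mul]
        simp only [Finset.sum_ite_mem, univ_inter, Finset.sum_const, nsmul_eq_mul, mul_one]
        field_simp
    _ ≤ _ := by
        refine add_le_add_left ?_ _
        rw [div_le_iff₀ hW]
        exact (card_filter_not_injective_le (m := m) φ g).trans_eq (by ring)

open Classical in
/-- The failure rate is concentrated around its mean, because no single element of `α` influences
it by more than `2 ^ m / |V|`. -/
theorem bernoulliMean_failureRate_ge_le {p : ℝ} (hp : 0 ≤ p) (hp' : p ≤ 1) (φ : V ≃ α) (g : V)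
    (hmean : bernoulliMean p univ (failureRate E m φ g) ≤ 1 / 8) :
    bernoulliMean p univ (fun S => if 1 / 3 ≤ failureRate E m φ g S then 1 else 0) ≤
      Real.exp (-(Fintype.card V / (96 * 4 ^ m))) := by
  set L : ℝ := (Fintype.card V : ℝ) with hL
  have hL0 : 0 < L := by rw [hL]; exact_mod_cast Fintype.card_pos
  have hcard : (#(univ : Finset α) : ℝ) = L := by rw [card_univ, hL, Fintype.card_congr φ]
  -- The exponent is `-L * τ / 3 + L * τ / 8 + L * (τ * 2 ^ m) ^ 2`; this `τ` makes the last summand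
  -- `L * τ / 8`, which leaves `-L * τ / 12`.
  set τ : ℝ := 1 / (8 * 4 ^ m) with hτ
  have hτ0 : 0 < τ := by positivity
  have h4 : (4 : ℝ) ^ m = 2 ^ m * 2 ^ m := by rw [← mul_pow]; norm_num
  have h2m : (1 : ℝ) ≤ 2 ^ m := one_le_pow₀ (by norm_num)
  have hc : τ * 2 ^ m ≤ 1 := by
    rw [hτ, div_mul_eq_mul_div, one_mul, div_le_one (by positivity), h4]
    nlinarith
  have hexp := bernoulliMean_exp_le hp hp' hc (univ : Finset α)
    (fun S => (L * τ) * failureRate E m φ g S) fun b S => by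
      rw [← mul_sub, abs_mul, abs_of_pos (mul_pos hL0 hτ0)]
      calc _ ≤ L * τ * (2 ^ m / L) :=
            mul_le_mul_of_nonneg_left (abs_failureRate_insert_sub_le φ g b S) (by positivity)
        _ = _ := by field_simp
  calc _ ≤ bernoulliMean p univ (fun S => Real.exp (-(L * τ / 3)) *
        Real.exp ((L * τ) * failureRate E m φ g S)) := by
        refine bernoulliMean_mono hp hp' _ fun S _ => ?_
        split_ifs with h
        · rw [← Real.exp_add]
          refine Real.one_le_exp ?_
          nlinarith [mul_pos hL0 hτ0]
        · positivity
    _ ≤ Real.exp (-(L * τ / 3)) * Real.exp (L * τ * (1 / 8) + L * (τ * 2 ^ m) ^ 2) := by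
        rw [bernoulliMean_const_mul]
        refine mul_le_mul_of_nonneg_left (hexp.trans (Real.exp_le_exp.2 ?_)) (Real.exp_pos _).le
        rw [hcard, bernoulliMean_const_mul]
        have := mul_le_mul_of_nonneg_left hmean (mul_pos hL0 hτ0).le
        linarith
    _ = _ := by
        rw [← Real.exp_add]
        congr 1
        have : (τ * 2 ^ m) ^ 2 = τ * (1 / 8) := by
          rw [mul_pow, ← pow_mul, mul_comm m 2, pow_mul, hτ]
          norm_num
          field_simp
        rw [this, hτ]
        field_simp
        norm_num

end failure

/-! ### Bounding runs of programs -/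

section Reaches

variable {n : ℕ} (O : SimpleGraph (Fin n) → ZMod 2) (ρ : ℕ → Bool)

/-- Started in `s`, the program halts with cost at most `T` in a state that satisfies `Q`. -/
def Reaches (P : RamProg) (s : RamState) (T : ℕ) (Q : RamState → Prop) : Prop :=
  ∃ s' t, Exec O ρ P s s' t ∧ t ≤ T ∧ Q s'

/-- A bound for the cost of an instruction that is not a query and handles numbers up to `B`. -/
def unitCost (B : ℕ) : ℕ := (1 + B.size) ^ 2

variable {O ρ} {s : RamState} {Q : RamState → Prop} {p q : RamProg} {B T T' : ℕ}

theorem le_unitCost {a b : ℕ} (ha : a ≤ B) (hb : b ≤ B) : 1 + a.size + b.size ≤ unitCost B := by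
  have h1 := Nat.size_le_size ha
  have h2 := Nat.size_le_size hb
  rw [unitCost]
  nlinarith

theorem one_add_size_le_unitCost {a : ℕ} (ha : a ≤ B) : 1 + a.size ≤ unitCost B :=
  (Nat.le_add_right _ _).trans (le_unitCost ha ha)

theorem ArithOp.cost_le_unitCost (op : ArithOp) {a b : ℕ} (ha : a ≤ B) (hb : b ≤ B) :
    op.cost a b ≤ unitCost B := by
  have hmul : (1 + a.size) * (1 + b.size) ≤ unitCost B := by
    rw [unitCost, sq]
    exact Nat.mul_le_mul (Nat.add_le_add_left (Nat.size_le_size ha) 1)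
      (Nat.add_le_add_left (Nat.size_le_size hb) 1)
  cases op
  · exact le_unitCost ha hb
  · exact le_unitCost ha hb
  all_goals exact hmul

namespace Reaches

theorem mono {Q' : RamState → Prop} (h : Reaches O ρ p s T Q) (hT : T ≤ T')
    (hQ : ∀ s', Q s' → Q' s') : Reaches O ρ p s T' Q' := by
  obtain ⟨s', t, he, ht, hq⟩ := h
  exact ⟨s', t, he, ht.trans hT, hQ s' hq⟩

theorem seq (h : Reaches O ρ p s T fun s' => Reaches O ρ q s' T' Q) :
    Reaches O ρ (.seq p q) s (T + T') Q := by
  obtain ⟨s', t, he, ht, s'', t', he', ht', hq⟩ := h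
  exact ⟨s'', t + t', he.seq he', Nat.add_le_add ht ht', hq⟩

theorem const {d v : ℕ} (hv : v ≤ B) (hQ : Q { s with reg := Function.update s.reg d v }) :
    Reaches O ρ (.const d v) s (unitCost B) Q :=
  ⟨_, _, .const d v s, one_add_size_le_unitCost hv, hQ⟩

theorem arith {op : ArithOp} {d a b : ℕ} (ha : s.reg a ≤ B) (hb : s.reg b ≤ B)
    (hQ : Q { s with reg := Function.update s.reg d (op.eval (s.reg a) (s.reg b)) }) :
    Reaches O ρ (.arith op d a b) s (unitCost B) Q :=
  ⟨_, _, .arith op d a b s, op.cost_le_unitCost ha hb, hQ⟩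

theorem load {d a : ℕ} (ha : s.reg a ≤ B) (hb : s.mem (s.reg a) ≤ B)
    (hQ : Q { s with reg := Function.update s.reg d (s.mem (s.reg a)) }) :
    Reaches O ρ (.load d a) s (unitCost B) Q :=
  ⟨_, _, .load d a s, le_unitCost ha hb, hQ⟩

theorem store {a b : ℕ} (ha : s.reg a ≤ B) (hb : s.reg b ≤ B)
    (hQ : Q { s with mem := Function.update s.mem (s.reg a) (s.reg b) }) :
    Reaches O ρ (.store a b) s (unitCost B) Q :=
  ⟨_, _, .store a b s, le_unitCost ha hb, hQ⟩

theorem coin {d : ℕ} (hQ : Q { s with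
      reg := Function.update s.reg d (ρ s.tossed).toNat, tossed := s.tossed + 1 }) :
    Reaches O ρ (.coin d) s (unitCost B) Q :=
  ⟨_, _, .coin d s, Nat.one_le_pow _ _ (by omega), hQ⟩

theorem query {d a : ℕ} (ha : s.reg a ≤ B)
    (hQ : Q { s with reg := Function.update s.reg d (O (storedGraph n s.mem (s.reg a))).val }) :
    Reaches O ρ (.query d a) s (unitCost B + n ^ 2) Q :=
  ⟨_, _, .query d a s, Nat.add_le_add_right (one_add_size_le_unitCost ha) _, hQ⟩

theorem ite {r : ℕ} (hr : s.reg r ≤ B) (hp : s.reg r ≠ 0 → Reaches O ρ p s T Q)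
    (hq : s.reg r = 0 → Reaches O ρ q s T Q) :
    Reaches O ρ (.ite r p q) s (unitCost B + T) Q := by
  by_cases h : s.reg r = 0
  · obtain ⟨s', t, he, ht, hQ⟩ := hq h
    refine ⟨s', _, .ite_false h he, ?_, hQ⟩
    have := one_add_size_le_unitCost hr
    omega
  · obtain ⟨s', t, he, ht, hQ⟩ := hp h
    refine ⟨s', _, .ite_true h he, ?_, hQ⟩
    have := one_add_size_le_unitCost hr
    omega

/-- A loop whose counter `r` goes down by one in each iteration. -/
theorem loop {r : ℕ} (Inv : ℕ → RamState → Prop) (hreg : ∀ a s, Inv a s → s.reg r = a)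
    {N : ℕ} (hN : N ≤ B)
    (hstep : ∀ a s, a < N → Inv (a + 1) s → Reaches O ρ p s T (Inv a)) (a : ℕ) (ha : a ≤ N)
    (hs : Inv a s) :
    Reaches O ρ (.loop r p) s (a * (unitCost B + T) + unitCost B) (Inv 0) := by
  induction a generalizing s with
  | zero => exact ⟨s, 1, .loop_done (hreg 0 s hs), Nat.le_add_left_of_le
      (Nat.one_le_pow _ _ (by omega)), hs⟩
  | succ a ih =>
    obtain ⟨s', t, he, ht, hs'⟩ := hstep a s ha hs
    obtain ⟨s'', t', he', ht', hs''⟩ := ih (by omega) hs'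
    have hr : s.reg r = a + 1 := hreg _ _ hs
    refine ⟨s'', _, .loop_step (by omega) he he', ?_, hs''⟩
    have := one_add_size_le_unitCost (B := B) (a := s.reg r) (by omega)
    rw [add_mul, one_mul]
    omega

end Reaches

end Reaches

/-! ### The program -/

/- Register `0` holds `n`, register `1` holds `n ^ 2`, register `2` the current cell `a`, register
`3` the constant `0`, register `4` the constant `1` and register `5` the constant `2`. Register `6`
holds the factor that vanishes on and below the diagonal, register `7` the entry of the input,
register `9` an address and register `10` a number to be stored or an answer of the oracle.
Registers from `11` on hold the coins that have been tossed for the current cell. -/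

/-- Leaves a state unchanged whose register `3` is `0`. -/
def skipProg : RamProg := .const 3 0

/-- Toss `m` coins into the registers from `11` on. -/
def tossProg : ℕ → RamProg
  | 0 => skipProg
  | m + 1 => .seq (tossProg m) (.coin (11 + m))

/-- Add the coins named in the list to register `10`. -/
def addCoinsProg : List ℕ → RamProg
  | [] => skipProg
  | i :: l => .seq (.arith .add 10 10 (11 + i)) (addCoinsProg l)

/-- Advance the address in register `9` by `n ^ 2` and store there the parity of register `7` plus
the coins named in the list, multiplied by register `6`. -/
def writeProg (l : List ℕ) : RamProg :=
  .seq (.arith .add 9 9 1) <| .seq (.arith .add 10 7 3) <| .seq (addCoinsProg l) <|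
    .seq (.arith .mod 10 10 5) <| .seq (.arith .mul 10 10 6) (.store 9 10)

/-- `writeProg` for each of the lists in turn. -/
def writeAllProg : List (List ℕ) → RamProg
  | [] => skipProg
  | l :: ls => .seq (writeProg l) (writeAllProg ls)

/-- Decrease `a`, so that the cells are processed from the last one to the first one, and write the
entries at `a` of all matrices. The factor `a % n - a / n` (a truncated subtraction) in register
`6` is nonzero if and only if the cell is above the diagonal. -/
def cellProg (m : ℕ) (ls : List (List ℕ)) : RamProg :=
  .seq (.arith .sub 2 2 4) <| .seq (.arith .div 6 2 0) <| .seq (.arith .mod 7 2 0) <|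
    .seq (.arith .sub 6 7 6) <| .seq (.load 7 2) <| .seq (tossProg m) <|
      .seq (.arith .add 9 2 3) (writeAllProg ls)

/-- Query `K` graphs whose matrices are stored one after the other, and output the value of `f` at
the answers: a binary decision tree. -/
def treeProg : (K : ℕ) → ((Fin K → Bool) → ℕ) → RamProg
  | 0, f => .const 0 (f Fin.elim0)
  | K + 1, f => .seq (.arith .add 9 9 1) <| .seq (.query 10 9) <|
      .ite 10 (treeProg K fun v => f (Fin.cons true v)) (treeProg K fun v => f (Fin.cons false v))

/-- The complete program: `ls` lists, for each query, the directions that are added to the input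
graph. -/
def decodeProg (m : ℕ) (ls : List (List ℕ)) (f : (Fin ls.length → Bool) → ℕ) : RamProg :=
  .seq (.const 3 0) <| .seq (.const 4 1) <| .seq (.const 5 2) <| .seq (.arith .mul 1 0 0) <|
    .seq (.arith .add 2 1 3) <| .seq (.loop 2 (cellProg m ls)) <|
      .seq (.const 9 0) (treeProg ls.length f)

section program

variable {n : ℕ} {O : SimpleGraph (Fin n) → ZMod 2} {ρ : ℕ → Bool} {s : RamState}
  {Q : RamState → Prop} {B : ℕ}

theorem reaches_skipProg (h3 : s.reg 3 = 0) (hQ : Q s) :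
    Reaches O ρ skipProg s (unitCost B) Q := by
  refine Reaches.const (Nat.zero_le B) ?_
  rwa [← h3, Function.update_eq_self]

theorem reaches_tossProg (m : ℕ) (h3 : s.reg 3 = 0)
    (hQ : Q { s with
      reg := fun r => if 11 ≤ r ∧ r < 11 + m then (ρ (s.tossed + (r - 11))).toNat else s.reg r
      tossed := s.tossed + m }) :
    Reaches O ρ (tossProg m) s ((m + 1) * unitCost B) Q := by
  induction m generalizing Q with
  | zero =>
    rw [zero_add, one_mul]
    refine reaches_skipProg h3 ?_
    convert hQ using 1
    cases s
    simp only [RamState.mk.injEq, add_zero, and_true]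
    funext r
    rw [if_neg (by omega)]
  | succ m ih =>
    rw [add_mul (m + 1), one_mul]
    refine Reaches.seq (ih (Reaches.coin ?_))
    convert hQ using 2
    · funext r
      rw [Function.update_apply]
      by_cases h : r = 11 + m
      · subst h
        rw [if_pos rfl, if_pos (by omega)]
        simp
      · rw [if_neg h]
        refine if_congr ?_ rfl rfl
        omega
    · exact add_assoc _ _ _

theorem reaches_addCoinsProg (l : List ℕ) (h3 : s.reg 3 = 0)
    (hB : s.reg 10 + (l.map fun i => s.reg (11 + i)).sum ≤ B)
    (hQ : Q { s with
      reg := Function.update s.reg 10 (s.reg 10 + (l.map fun i => s.reg (11 + i)).sum) }) :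
    Reaches O ρ (addCoinsProg l) s ((l.length + 1) * unitCost B) Q := by
  induction l generalizing s with
  | nil =>
    rw [List.length_nil, zero_add, one_mul]
    refine reaches_skipProg h3 ?_
    simpa using hQ
  | cons i l ih =>
    rw [List.map_cons, List.sum_cons] at hB hQ
    have hne : ∀ j, 11 + j ≠ 10 := fun j => by omega
    rw [List.length_cons, add_mul (l.length + 1), one_mul, add_comm]
    refine Reaches.seq (Reaches.arith (by omega) (by omega) (ih ?_ ?_ ?_))
    · simpa using h3
    · simp only [ArithOp.eval, Function.update_self, Function.update_of_ne (hne _)]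
      omega
    · simpa only [ArithOp.eval, Function.update_self, Function.update_of_ne (hne _),
        Function.update_idem, add_assoc] using hQ

/-- The number that `writeProg` stores. -/
def writtenValue (reg : ℕ → ℕ) (l : List ℕ) : ℕ :=
  (reg 7 + (l.map fun i => reg (11 + i)).sum) % 2 * reg 6

theorem reaches_writeProg (l : List ℕ) (h3 : s.reg 3 = 0) (h5 : s.reg 5 = 2) (h6 : s.reg 6 ≤ B)
    (h9 : s.reg 9 + s.reg 1 ≤ B) (hB2 : 2 ≤ B)
    (hB : s.reg 7 + (l.map fun i => s.reg (11 + i)).sum ≤ B)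
    (hQ : Q { s with
      reg := Function.update (Function.update s.reg 9 (s.reg 9 + s.reg 1)) 10
        (writtenValue s.reg l)
      mem := Function.update s.mem (s.reg 9 + s.reg 1) (writtenValue s.reg l) }) :
    Reaches O ρ (writeProg l) s ((l.length + 6) * unitCost B) Q := by
  have hne9 : ∀ j, 11 + j ≠ 9 := fun j => by omega
  have hne10 : ∀ j, 11 + j ≠ 10 := fun j => by omega
  have hval : writtenValue s.reg l ≤ B := by
    rw [writtenValue]
    have := Nat.mod_lt (s.reg 7 + (l.map fun i => s.reg (11 + i)).sum) (y := 2) (by omega)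
    calc _ ≤ 1 * s.reg 6 := Nat.mul_le_mul_right _ (by omega)
      _ ≤ B := by omega
  refine Reaches.mono (T := unitCost B + (unitCost B + ((l.length + 1) * unitCost B +
    (unitCost B + (unitCost B + unitCost B))))) ?_ (by ring_nf; rfl) fun _ h => h
  refine .seq (.arith (by omega) (by omega) (.seq (.arith ?_ ?_ (.seq
    (reaches_addCoinsProg l ?_ ?_ (.seq (.arith ?_ ?_ (.seq (.arith ?_ ?_ (.store ?_ ?_ ?_))))))))))
  · simp; omega
  · simp [h3]
  · simp [h3]
  · simpa [ArithOp.eval, h3, Function.update_of_ne (hne9 _), Function.update_of_ne (hne10 _)]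
      using hB
  · simpa [ArithOp.eval, h3, Function.update_of_ne (hne9 _), Function.update_of_ne (hne10 _)]
      using hB
  · simpa [h5] using hB2
  · simp only [ArithOp.eval, Function.update_self]
    refine (Nat.mod_le _ _).trans ?_
    simpa [ArithOp.eval, h3, Function.update_of_ne (hne9 _), Function.update_of_ne (hne10 _)]
      using hB
  · simpa using h6
  · simpa [ArithOp.eval] using h9
  · simpa [ArithOp.eval, h3, h5, Function.update_of_ne (hne9 _), Function.update_of_ne (hne10 _),
      writtenValue] using hval
  · convert hQ using 1
    simp [ArithOp.eval, h3, h5, Function.update_of_ne (hne9 _), Function.update_of_ne (hne10 _),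
      writtenValue]

/-- The number of instructions of `writeAllProg ls`. -/
def writeAllSteps (ls : List (List ℕ)) : ℕ := (ls.map fun l => l.length + 6).sum + 1

theorem reaches_writeAllProg (ls : List (List ℕ)) (h1 : 0 < s.reg 1) (h3 : s.reg 3 = 0)
    (h5 : s.reg 5 = 2) (h6 : s.reg 6 ≤ B) (h9 : s.reg 9 + ls.length * s.reg 1 ≤ B) (hB2 : 2 ≤ B)
    (hB : ∀ l ∈ ls, s.reg 7 + (l.map fun i => s.reg (11 + i)).sum ≤ B)
    (hQ : ∀ s' : RamState, (∀ r, r ≠ 9 → r ≠ 10 → s'.reg r = s.reg r) → s'.tossed = s.tossed →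
      (∀ i (hi : i < ls.length),
        s'.mem (s.reg 9 + (i + 1) * s.reg 1) = writtenValue s.reg ls[i]) →
      (∀ b, (∀ i < ls.length, b ≠ s.reg 9 + (i + 1) * s.reg 1) → s'.mem b = s.mem b) → Q s') :
    Reaches O ρ (writeAllProg ls) s (writeAllSteps ls * unitCost B) Q := by
  induction ls generalizing s with
  | nil =>
    rw [writeAllSteps, List.map_nil, List.sum_nil, zero_add, one_mul]
    exact reaches_skipProg h3 (hQ s (fun _ _ _ => rfl) rfl (fun i hi => by simp at hi)
      fun _ _ => rfl)
  | cons l ls ih =>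
    rw [List.length_cons, add_mul, one_mul] at h9
    have hsteps : writeAllSteps (l :: ls) * unitCost B =
        (l.length + 6) * unitCost B + writeAllSteps ls * unitCost B := by
      simp only [writeAllSteps, List.map_cons, List.sum_cons]
      ring
    rw [hsteps]
    refine Reaches.seq (reaches_writeProg l h3 h5 h6 (by omega) hB2 (hB l (by simp)) ?_)
    have hne9 : ∀ j, 11 + j ≠ 9 := fun j => by omega
    have hne10 : ∀ j, 11 + j ≠ 10 := fun j => by omega
    refine ih (by simpa using h1) (by simpa using h3) (by simpa using h5) (by simpa using h6)
      ?_ ?_ ?_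
    · simp
      omega
    · intro l' hl'
      simpa [Function.update_of_ne (hne9 _), Function.update_of_ne (hne10 _)] using
        hB l' (by simp [hl'])
    · intro s' hreg htoss hmem hother
      have e9 : ∀ i, s.reg 9 + s.reg 1 + (i + 1) * s.reg 1 = s.reg 9 + (i + 1 + 1) * s.reg 1 :=
        fun i => by ring
      simp only [Function.update_self, Function.update_of_ne (show (9 : ℕ) ≠ 10 by decide),
        Function.update_of_ne (show (1 : ℕ) ≠ 9 by decide),
        Function.update_of_ne (show (1 : ℕ) ≠ 10 by decide), e9] at hmem hother
      refine hQ s' (fun r hr hr' => ?_) htoss ?_ ?_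
      · rw [hreg r hr hr']
        simp [hr, hr']
      · intro i hi
        cases i with
        | zero =>
          have := hother (s.reg 9 + s.reg 1) fun i _ h => by
            have : (i + 1 + 1) * s.reg 1 = (i + 1) * s.reg 1 + s.reg 1 := by ring
            have : 0 < (i + 1) * s.reg 1 := by positivity
            omega
          simpa using this
        | succ i =>
          rw [hmem i (by simpa using hi)]
          simp [writtenValue, Function.update_of_ne (hne9 _), Function.update_of_ne (hne10 _)]
      · intro b hb
        rw [hother b fun i hi => hb (i + 1) (by simpa using hi)]
        have := hb 0 (by simp)
        rw [Function.update_of_ne (by simpa using this)]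

/-- The entry at cell `b` of the matrix of the query with directions `l`, if `M` is the input. -/
def cellValue (n m : ℕ) (ρ : ℕ → Bool) (M : ℕ → ℕ) (b : ℕ) (l : List ℕ) : ℕ :=
  (M b + (l.map fun i => (ρ ((n * n - 1 - b) * m + i)).toNat).sum) % 2 * (b % n - b / n)

/-- The invariant of the main loop: the cells from `a` on have been processed. -/
structure CellInv (n m : ℕ) (ls : List (List ℕ)) (ρ : ℕ → Bool) (M : ℕ → ℕ) (a : ℕ)
    (s : RamState) : Prop where
  reg0 : s.reg 0 = n
  reg1 : s.reg 1 = n * n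
  reg2 : s.reg 2 = a
  reg3 : s.reg 3 = 0
  reg4 : s.reg 4 = 1
  reg5 : s.reg 5 = 2
  tossed : s.tossed = (n * n - a) * m
  mem_low : ∀ b < n * n, s.mem b = M b
  mem_high : ∀ b, a ≤ b → b < n * n → ∀ i (hi : i < ls.length),
    s.mem (b + (i + 1) * (n * n)) = cellValue n m ρ M b ls[i]

/-- A bound for all numbers in the registers. -/
def regBound (n m : ℕ) (ls : List (List ℕ)) : ℕ := (ls.length + 1) * (n * n) + n + m + 2

theorem reaches_cellProg {m : ℕ} {ls : List (List ℕ)} {M : ℕ → ℕ} (hM : ∀ b, M b ≤ 1)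
    (hls : ∀ l ∈ ls, l.length ≤ m ∧ ∀ i ∈ l, i < m) {a : ℕ} (ha : a < n * n)
    (hs : CellInv n m ls ρ M (a + 1) s) :
    Reaches O ρ (cellProg m ls) s ((writeAllSteps ls + m + 7) * unitCost (regBound n m ls))
      (CellInv n m ls ρ M a) := by
  obtain ⟨h0, h1, h2, h3, h4, h5, ht, hlow, hhigh⟩ := hs
  set B := regBound n m ls with hBdef
  have hBB : B = ls.length * (n * n) + n * n + n + m + 2 := by rw [hBdef, regBound]; ring
  have haN : a % n ≤ n := (Nat.mod_lt _ (Nat.pos_of_ne_zero (by rintro rfl; simp at ha))).le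
  have haD : a / n ≤ a := Nat.div_le_self _ _
  have hMa := hM a
  have hcoin : ∀ (l : List ℕ) (c : ℕ → Bool),
      (l.map fun i => (c i).toNat).sum ≤ l.length := fun l c => by
    refine (List.sum_le_card_nsmul _ 1 fun x hx => ?_).trans_eq (by simp)
    obtain ⟨i, _, rfl⟩ := List.mem_map.1 hx
    exact Bool.toNat_le _
  refine Reaches.mono (T := unitCost B + (unitCost B + (unitCost B + (unitCost B + (unitCost B +
    ((m + 1) * unitCost B + (unitCost B + writeAllSteps ls * unitCost B))))))) ?_
    (by ring_nf; rfl) fun _ h => h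
  clear_value B
  -- The state after the coins have been tossed.
  suffices h : ∀ s1 : RamState, (∀ r < 6, r ≠ 2 → s1.reg r = s.reg r) → s1.reg 2 = a →
      s1.reg 6 = a % n - a / n → s1.reg 7 = M a → s1.reg 9 = a →
      (∀ i < m, s1.reg (11 + i) = (ρ ((n * n - 1 - a) * m + i)).toNat) →
      s1.tossed = (n * n - a) * m → s1.mem = s.mem →
      Reaches O ρ (writeAllProg ls) s1 (writeAllSteps ls * unitCost B) (CellInv n m ls ρ M a) by
    refine .seq (.arith (by omega) (by omega) (.seq (.arith ?_ ?_ (.seq (.arith ?_ ?_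
      (.seq (.arith ?_ ?_ (.seq (.load ?_ ?_ (.seq (reaches_tossProg m ?_ (.seq (.arith ?_ ?_
        (h _ ?_ ?_ ?_ ?_ ?_ ?_ ?_ ?_))))))))))))))
    · simp [ArithOp.eval, h2, h4]; omega
    · simp [h0]; omega
    · simp [ArithOp.eval, h2, h4]; omega
    · simp [h0]; omega
    · simp [ArithOp.eval, h2, h4, h0]; omega
    · simp [ArithOp.eval, h2, h4, h0]; omega
    · simp [ArithOp.eval, h2, h4]; omega
    · simp [ArithOp.eval, h2, h4, hlow a ha]; omega
    · simpa [ArithOp.eval] using h3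
    · simp [ArithOp.eval, h2, h4]; omega
    · simp [h3]
    · intro r hr hr2
      have : ¬ 11 ≤ r := by omega
      have : r ≠ 6 := by omega
      have : r ≠ 7 := by omega
      have : r ≠ 9 := by omega
      simp [*]
    · simp [ArithOp.eval, h2, h4]
    · simp [ArithOp.eval, h2, h4, h0]
    · simp [ArithOp.eval, h2, h4, hlow a ha]
    · simp [ArithOp.eval, h2, h4, h3]
    · intro i hi
      have : 11 + i ≠ 9 := by omega
      have : n * n - (a + 1) = n * n - 1 - a := by omega
      simp [*]
    · have : n * n - a = n * n - (a + 1) + 1 := by omega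
      simp only [ht, this, add_mul, one_mul]
    · rfl
  intro s1 hr hr2 hr6 hr7 hr9 hcoins ht1 hmem1
  have hr0 := hr 0 (by omega) (by omega)
  have hr1 := hr 1 (by omega) (by omega)
  have hr3 := hr 3 (by omega) (by omega)
  have hr4 := hr 4 (by omega) (by omega)
  have hr5 := hr 5 (by omega) (by omega)
  rw [h0] at hr0
  rw [h1] at hr1
  rw [h3] at hr3
  rw [h4] at hr4
  rw [h5] at hr5
  have hmap : ∀ l ∈ ls, (l.map fun i => s1.reg (11 + i)) =
      l.map fun i => (ρ ((n * n - 1 - a) * m + i)).toNat := fun l hl =>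
    List.map_congr_left fun i hi => hcoins i ((hls l hl).2 i hi)
  have hsub : a % n - a / n ≤ n := (Nat.sub_le _ _).trans haN
  refine reaches_writeAllProg ls (by omega) hr3 hr5 (by omega) ?_ (by omega) ?_ ?_
  · rw [hr9, hr1]
    omega
  · intro l hl
    rw [hmap l hl, hr7]
    have := hcoin l fun i => ρ ((n * n - 1 - a) * m + i)
    have := (hls l hl).1
    omega
  · intro s' hreg htoss hmem hother
    rw [hr9, hr1] at hmem hother
    have hge : ∀ b < n * n, ∀ i, b ≠ a + (i + 1) * (n * n) := fun b hb i h => by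
      rw [add_mul, one_mul] at h
      omega
    refine ⟨?_, ?_, ?_, ?_, ?_, ?_, htoss.trans ht1, ?_, ?_⟩
    · rw [hreg 0 (by omega) (by omega), hr0]
    · rw [hreg 1 (by omega) (by omega), hr1]
    · rw [hreg 2 (by omega) (by omega), hr2]
    · rw [hreg 3 (by omega) (by omega), hr3]
    · rw [hreg 4 (by omega) (by omega), hr4]
    · rw [hreg 5 (by omega) (by omega), hr5]
    · intro b hb
      rw [hother b fun i _ => hge b hb i, hmem1, hlow b hb]
    · intro b hab hb i hi
      rcases hab.eq_or_lt with rfl | hab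
      · rw [hmem i hi, writtenValue, hmap _ (List.getElem_mem hi), hr7, hr6, cellValue]
      · rw [hother, hmem1, hhigh b hab hb i hi]
        intro j _ h
        have h' := congrArg (· % (n * n)) h
        simp only [Nat.add_mul_mod_self_right, Nat.mod_eq_of_lt hb, Nat.mod_eq_of_lt ha] at h'
        omega

theorem reaches_treeProg (K : ℕ) (f : (Fin K → Bool) → ℕ) (hf : ∀ v, f v ≤ B) (hB : 1 ≤ B)
    (h9 : s.reg 9 + K * s.reg 1 ≤ B)
    (hQ : ∀ s' : RamState, s'.reg 0 = f (fun i : Fin K =>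
      decide (O (storedGraph n s.mem (s.reg 9 + (i + 1) * s.reg 1)) ≠ 0)) → Q s') :
    Reaches O ρ (treeProg K f) s (K * (3 * unitCost B + n ^ 2) + unitCost B) Q := by
  induction K generalizing s with
  | zero =>
    rw [zero_mul, zero_add]
    refine Reaches.const (hf _) (hQ _ ?_)
    simp only [Function.update_self]
    congr 1
    exact Subsingleton.elim _ _
  | succ K ih =>
    rw [add_mul, one_mul] at h9
    refine Reaches.mono (T := unitCost B + ((unitCost B + n ^ 2) + (unitCost B +
      (K * (3 * unitCost B + n ^ 2) + unitCost B)))) ?_ (by ring_nf; rfl) fun _ h => h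
    have e9 : ∀ i, s.reg 9 + s.reg 1 + (i + 1) * s.reg 1 = s.reg 9 + (i + 1 + 1) * s.reg 1 :=
      fun i => by ring
    set o : ZMod 2 := O (storedGraph n s.mem (s.reg 9 + s.reg 1)) with ho
    have hcons : ∀ (b : Bool), b = decide (o ≠ 0) →
        (Fin.cons b (fun i : Fin K =>
          decide (O (storedGraph n s.mem (s.reg 9 + (i + 1 + 1) * s.reg 1)) ≠ 0)) :
            Fin (K + 1) → Bool) =
        fun i : Fin (K + 1) =>
          decide (O (storedGraph n s.mem (s.reg 9 + (i + 1) * s.reg 1)) ≠ 0) := fun b hb => by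
      funext i
      refine Fin.cases ?_ (fun i => ?_) i
      · simp [hb, ho]
      · simp
    refine .seq (.arith (by omega) (by omega) (.seq (.query ?_ (.ite ?_ ?_ ?_))))
    · simp [ArithOp.eval]; omega
    · simp only [Function.update_self]
      exact (Nat.le_of_lt_succ (ZMod.val_lt _)).trans hB
    · intro h
      refine ih _ (fun v => hf _) ?_ ?_
      · simp [ArithOp.eval]; omega
      · intro s' hs'
        refine hQ s' ?_
        have ho' : o ≠ 0 := by simpa [ArithOp.eval, ho] using h
        rw [hs', ← hcons true (by simp [ho'])]
        simp [ArithOp.eval, e9]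
    · intro h
      refine ih _ (fun v => hf _) ?_ ?_
      · simp [ArithOp.eval]; omega
      · intro s' hs'
        refine hQ s' ?_
        have ho' : o = 0 := by simpa [ArithOp.eval, ho] using h
        rw [hs', ← hcons false (by simp [ho'])]
        simp [ArithOp.eval, e9]

/-- A bound for the cost of `decodeProg`. -/
def decodeCost (n m : ℕ) (ls : List (List ℕ)) : ℕ :=
  (n * n * (writeAllSteps ls + m + 8) + 3 * ls.length + 8) * unitCost (regBound n m ls) +
    ls.length * n ^ 2

theorem initState_mem_le_one (G : SimpleGraph (Fin n)) (b : ℕ) : (initState G).mem b ≤ 1 := by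
  simp only [initState]
  split_ifs <;> omega

theorem reaches_decodeProg {m : ℕ} {ls : List (List ℕ)}
    (hls : ∀ l ∈ ls, l.length ≤ m ∧ ∀ i ∈ l, i < m) (f : (Fin ls.length → Bool) → ℕ)
    (hf : ∀ v, f v ≤ 1) (G : SimpleGraph (Fin n)) :
    Reaches O ρ (decodeProg m ls f) (initState G) (decodeCost n m ls) fun s =>
      ∃ mem : ℕ → ℕ, (∀ b < n * n, ∀ i (hi : i < ls.length), mem (b + (i + 1) * (n * n)) =
        cellValue n m ρ (initState G).mem b ls[i]) ∧
      s.reg 0 = f fun i => decide (O (storedGraph n mem ((i + 1) * (n * n))) ≠ 0) := by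
  set M := (initState G).mem with hM
  set B := regBound n m ls with hBdef
  have hBB : B = ls.length * (n * n) + n * n + n + m + 2 := by rw [hBdef, regBound]; ring
  refine Reaches.mono (T := unitCost B + (unitCost B + (unitCost B + (unitCost B + (unitCost B +
    ((n * n * (unitCost B + (writeAllSteps ls + m + 7) * unitCost B) + unitCost B) + (unitCost B +
      (ls.length * (3 * unitCost B + n ^ 2) + unitCost B)))))))) ?_
    (by rw [decodeCost, ← hBdef]; exact le_of_eq (by ring)) fun _ h => h
  refine .seq (.const (by omega) (.seq (.const (by omega) (.seq (.const (by omega)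
    (.seq (.arith ?_ ?_ (.seq (.arith ?_ ?_ (.seq ?_))))))))))
  · simp [initState]; omega
  · simp [initState]; omega
  · simp [initState, ArithOp.eval]; omega
  · simp [initState]
  refine Reaches.mono (Reaches.loop (CellInv n m ls ρ M) (fun a s h => h.reg2) (N := n * n)
    (by omega) (fun a s ha hs => reaches_cellProg (initState_mem_le_one G) hls ha hs)
    (n * n) le_rfl ?_) le_rfl fun s hs => ?_
  · constructor <;> simp [initState, ArithOp.eval, hM]
    intro b h1 h2
    omega
  refine .seq (.const (Nat.zero_le _)
    (reaches_treeProg _ f (fun v => (hf v).trans (by omega)) (by omega) ?_ fun s' hs' => ?_))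
  · simp [hs.reg1]
    omega
  · refine ⟨s.mem, fun b hb i hi => hs.mem_high b (Nat.zero_le _) hb i hi, ?_⟩
    simpa [hs.reg1] using hs'

end program

/-! ### Graphs as vectors -/

/-- The possible edges of a graph on `n` labelled vertices. -/
abbrev VertexPair (n : ℕ) : Type := {p : Fin n × Fin n // p.1 < p.2}

theorem card_vertexPair (n : ℕ) : Fintype.card (VertexPair n) = n.choose 2 := by
  rw [Fintype.card_subtype, Finset.card_filter, Fintype.sum_prod_type_right]
  simp only [← Finset.card_filter]
  have : ∀ j : Fin n, #{i : Fin n | i < j} = j := fun j => by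
    rw [Finset.filter_gt_eq_Iio, Fin.card_Iio]
  rw [Finset.sum_congr rfl fun j _ => this j, Fin.sum_univ_eq_sum_range fun i => i,
    Finset.sum_range_id, Nat.choose_two_right]

open Classical in
/-- A graph corresponds to the vector of indicators of its edges. -/
noncomputable def graphEquiv (n : ℕ) : (VertexPair n → ZMod 2) ≃ SimpleGraph (Fin n) where
  toFun z := SimpleGraph.fromRel fun i j => ∃ h : i < j, z ⟨(i, j), h⟩ = 1
  invFun G p := if G.Adj p.1.1 p.1.2 then 1 else 0
  left_inv z := by
    have h2 : ∀ z : ZMod 2, z ≠ 1 → 0 = z := by decide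
    funext ⟨⟨i, j⟩, h⟩
    have h' : i < j := h
    have key : (SimpleGraph.fromRel fun i j => ∃ h : i < j, z ⟨(i, j), h⟩ = 1).Adj i j ↔
        z ⟨(i, j), h⟩ = 1 := by
      simp [h', h'.ne, h'.not_gt]
    by_cases hz : z ⟨(i, j), h⟩ = 1
    · exact (if_pos (key.2 hz)).trans hz.symm
    · exact (if_neg (mt key.1 hz)).trans (h2 _ hz)
  right_inv G := by
    ext i j
    rcases lt_trichotomy i j with h | rfl | h
    · simp [h, h.ne, h.not_gt]
    · simp
    · simp [h, h.ne', h.not_gt, G.adj_comm]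

theorem graphEquiv_adj {n : ℕ} (z : VertexPair n → ZMod 2) (p : VertexPair n) :
    (graphEquiv n z).Adj p.1.1 p.1.2 ↔ z p = 1 := by
  obtain ⟨⟨i, j⟩, h⟩ := p
  have h' : i < j := h
  simp [graphEquiv, h', h'.ne, h'.not_gt]

theorem card_graph (n : ℕ) : Fintype.card (VertexPair n → ZMod 2) = 2 ^ n.choose 2 := by
  rw [Fintype.card_fun, ZMod.card, card_vertexPair]

/-- The pair of vertices of the `k`-set `s` with the ranks `e.1` and `e.2`. -/
def pairOfRank {n k : ℕ} (s : {s : Finset (Fin n) // #s = k}) (e : VertexPair k) : VertexPair n :=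
  ⟨(s.1.orderEmbOfFin s.2 e.1.1, s.1.orderEmbOfFin s.2 e.1.2),
    (s.1.orderEmbOfFin s.2).strictMono e.2⟩

theorem cliqueParity_graphEquiv (k : ℕ) {n : ℕ} (z : VertexPair n → ZMod 2) :
    cliqueParity k (graphEquiv n z) =
      ∑ s : {s : Finset (Fin n) // #s = k}, ∏ e : VertexPair k, z (pairOfRank s e) := by
  classical
  have h01 : ∀ z : ZMod 2, z ≠ 1 → z = 0 := by decide
  have hclique : ∀ s : {s : Finset (Fin n) // #s = k},
      (graphEquiv n z).IsNClique k s.1 ↔ ∀ e : VertexPair k, z (pairOfRank s e) = 1 := fun s => by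
    rw [SimpleGraph.isNClique_iff, and_iff_left s.2, SimpleGraph.isClique_iff]
    have hrange : ∀ v ∈ s.1, ∃ i, s.1.orderEmbOfFin s.2 i = v := fun v hv => by
      have : v ∈ Set.range (s.1.orderEmbOfFin s.2) := by
        rw [Finset.range_orderEmbOfFin]
        exact hv
      exact this
    constructor
    · intro h e
      rw [← graphEquiv_adj]
      exact h (Finset.orderEmbOfFin_mem _ _ _) (Finset.orderEmbOfFin_mem _ _ _)
        (pairOfRank s e).2.ne
    · intro h v hv v' hv' hne
      obtain ⟨i, rfl⟩ := hrange v hv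
      obtain ⟨j, rfl⟩ := hrange v' hv'
      have hij : i ≠ j := fun h => hne (by rw [h])
      rcases hij.lt_or_gt with hlt | hlt
      · exact (graphEquiv_adj z (pairOfRank s ⟨(i, j), hlt⟩)).2 (h _)
      · exact ((graphEquiv_adj z (pairOfRank s ⟨(j, i), hlt⟩)).2 (h _)).symm
  have hprod : ∀ s : {s : Finset (Fin n) // #s = k}, ∏ e : VertexPair k, z (pairOfRank s e) =
      if (graphEquiv n z).IsNClique k s.1 then 1 else 0 := fun s => by
    split_ifs with h
    · exact Finset.prod_eq_one fun e _ => (hclique s).1 h e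
    · rw [hclique, not_forall] at h
      obtain ⟨e, he⟩ := h
      exact Finset.prod_eq_zero (mem_univ e) (h01 _ he)
  rw [Finset.sum_congr rfl fun s _ => hprod s, Finset.sum_boole, cliqueParity,
    Set.ncard_eq_toFinset_card']
  congr 1
  refine (Finset.card_bij (fun s _ => s.1) ?_ ?_ ?_).symm
  · intro s hs
    simpa using hs
  · intro s _ s' _ h
    exact Subtype.ext h
  · intro s hs
    have hs' : (graphEquiv n z).IsNClique k s := by simpa using hs
    exact ⟨⟨s, hs'.card_eq⟩, by simpa using hs', rfl⟩

/-- On an affine space of graphs, the parity of the number of cliques is a polynomial function whose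
monomials have at most as many factors as a clique has edges. -/
theorem exists_lowDegree_eq_cliqueParity (k : ℕ) {n m : ℕ} (g : VertexPair n → ZMod 2)
    (w : Fin m → VertexPair n → ZMod 2) :
    ∃ a : (VertexPair k → Option (Fin m)) → ZMod 2, ∀ x,
      cliqueParity k (subspacePoint (graphEquiv n) g w x) = lowDegree a x := by
  refine ⟨fun u => ∑ s : {s : Finset (Fin n) // #s = k}, ∏ e,
    (u e).elim (g (pairOfRank s e)) fun l => w l (pairOfRank s e), fun x => ?_⟩
  rw [subspacePoint, cliqueParity_graphEquiv, lowDegree_sum]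
  refine Finset.sum_congr rfl fun s _ => ?_
  rw [← prod_affine_eq_lowDegree fun e o =>
    o.elim (g (pairOfRank s e)) fun l => w l (pairOfRank s e)]
  refine Finset.prod_congr rfl fun e _ => ?_
  simp [Fintype.sum_option, affineCoord, mul_comm]

/-! ### Correctness of the program -/

/-- The list of directions with a nonzero coefficient in `x`. -/
noncomputable def directionList {m : ℕ} (x : Fin m → ZMod 2) : List ℕ :=
  (univ.filter fun l => x l ≠ 0).toList.map Fin.val

theorem directionList_spec {m : ℕ} (x : Fin m → ZMod 2) :
    (directionList x).length ≤ m ∧ ∀ i ∈ directionList x, i < m := by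
  constructor
  · rw [directionList, List.length_map, Finset.length_toList]
    exact (Finset.card_filter_le _ _).trans_eq (by simp)
  · intro i hi
    obtain ⟨l, _, rfl⟩ := List.mem_map.1 hi
    exact l.2

theorem sum_map_directionList {m : ℕ} (x : Fin m → ZMod 2) (c : ℕ → ℕ) :
    (((directionList x).map c).sum : ZMod 2) = ∑ l, x l * (c l : ZMod 2) := by
  rw [directionList, List.map_map, Finset.sum_map_toList, Nat.cast_sum, Finset.sum_filter]
  have h2 : ∀ a b : ZMod 2, (if a ≠ 0 then b else 0) = a * b := by decide
  exact Finset.sum_congr rfl fun l _ => h2 _ _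

/-- The points at which the program queries the oracle. -/
noncomputable def queryPoints (m : ℕ) : List (Fin m → ZMod 2) :=
  (univ.filter fun x : Fin m → ZMod 2 => x ≠ 0).toList

/-- The directions of all the queries. -/
noncomputable def queryLists (m : ℕ) : List (List ℕ) := (queryPoints m).map directionList

/-- The point of the `i`-th query. -/
noncomputable def queryPoint {m : ℕ} (i : Fin (queryLists m).length) : Fin m → ZMod 2 :=
  (queryPoints m)[(i : ℕ)]'(by simpa [queryLists] using i.2)

theorem exists_queryPoint_eq {m : ℕ} {x : Fin m → ZMod 2} (hx : x ≠ 0) :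
    ∃ i, queryPoint (m := m) i = x := by
  have : x ∈ queryPoints m := by simp [queryPoints, hx]
  obtain ⟨i, hi, h⟩ := List.getElem_of_mem this
  exact ⟨⟨i, by simpa [queryLists] using hi⟩, h⟩

theorem queryLists_getElem {m : ℕ} (i : Fin (queryLists m).length) :
    (queryLists m)[(i : ℕ)] = directionList (queryPoint i) := by
  simp [queryLists, queryPoint]

open Classical in
/-- The output of the program as a function of the answers of the oracle. -/
noncomputable def decodeAnswers (k m : ℕ) (v : Fin (queryLists m).length → Bool) : ℕ :=
  (decode (VertexPair k) fun x => if ∃ i, queryPoint i = x ∧ v i = true then 1 else 0).val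

theorem decodeAnswers_le_one (k m : ℕ) (v : Fin (queryLists m).length → Bool) :
    decodeAnswers k m v ≤ 1 :=
  Nat.le_of_lt_succ (ZMod.val_lt _)

/-- The randomized oracle algorithm: with random directions `w`, query the oracle at all points but
the input itself of the affine space through the input, and decode. -/
noncomputable def cliqueProg (k m : ℕ) : RamProg :=
  decodeProg m (queryLists m) (decodeAnswers k m)

/-- The index of the coin that determines the entry `p` of the direction `l`: the cells are processed
in decreasing order, and `m` coins are tossed for each of them, also on and below the diagonal. -/
def coinIndex (n m : ℕ) (q : Fin m × VertexPair n) : ℕ :=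
  (n * n - 1 - (q.2.1.1 * n + q.2.1.2)) * m + q.1

theorem cell_lt {n : ℕ} (i j : Fin n) : (i : ℕ) * n + j < n * n := by
  have hi := i.2
  have hj := j.2
  nlinarith

theorem cell_mod {n : ℕ} (i j : Fin n) : ((i : ℕ) * n + j) % n = j := by
  rw [mul_comm, Nat.mul_add_mod, Nat.mod_eq_of_lt j.2]

theorem cell_div {n : ℕ} (i j : Fin n) : ((i : ℕ) * n + j) / n = i := by
  rw [mul_comm, Nat.mul_add_div (Nat.zero_lt_of_lt j.2), Nat.div_eq_of_lt j.2, add_zero]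

theorem coinIndex_lt {n m : ℕ} (q : Fin m × VertexPair n) : coinIndex n m q < n * n * m := by
  have h := cell_lt q.2.1.1 q.2.1.2
  have hl := q.1.2
  have : (n * n - 1 - (q.2.1.1 * n + q.2.1.2) + 1) * m ≤ n * n * m :=
    Nat.mul_le_mul_right _ (by omega)
  rw [coinIndex]
  rw [add_mul] at this
  omega

theorem coinIndex_injective (n m : ℕ) : Function.Injective (coinIndex n m) := by
  rintro ⟨l, ⟨⟨i, j⟩, h⟩⟩ ⟨l', ⟨⟨i', j'⟩, h'⟩⟩ heq
  simp only [coinIndex] at heq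
  have hm : 0 < m := Nat.zero_lt_of_lt l.2
  have e : ∀ (c : ℕ) (l : Fin m), (c * m + l) % m = l ∧ (c * m + l) / m = c := fun c l => by
    rw [mul_comm, Nat.mul_add_mod, Nat.mod_eq_of_lt l.2, Nat.mul_add_div hm,
      Nat.div_eq_of_lt l.2]
    exact ⟨rfl, rfl⟩
  have h1 := congrArg (· % m) heq
  have h2 := congrArg (· / m) heq
  simp only [(e _ _).1] at h1
  simp only [(e _ _).2] at h2
  have hc := cell_lt i j
  have hc' := cell_lt i' j'
  have h3 : (i : ℕ) * n + j = i' * n + j' := by omega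
  have h4 := cell_mod i j
  have h5 := cell_div i j
  rw [h3, cell_mod] at h4
  rw [h3, cell_div] at h5
  have e1 := Fin.ext h1
  have e2 := Fin.ext h4.symm
  have e3 := Fin.ext h5.symm
  subst e1 e2 e3
  rfl

/-- The random directions that the program draws with the coins `ρ`. -/
def coinDirections (n m : ℕ) (ρ : ℕ → Bool) (l : Fin m) (p : VertexPair n) : ZMod 2 :=
  ((ρ (coinIndex n m (l, p))).toNat : ℕ)

/-- A stored number is nonzero if and only if the parity is odd and the cell is above the
diagonal. -/
theorem odd_mod_mul_ne_zero {a d : ℕ} : a % 2 * d ≠ 0 ↔ (a : ZMod 2) = 1 ∧ d ≠ 0 := by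
  rw [mul_ne_zero_iff]
  refine and_congr_left fun _ => ?_
  rw [ZMod.natCast_eq_one_iff_odd, Nat.odd_iff, ← Nat.mod_two_ne_zero]

/-- The matrix that the program writes for the coefficients `x` is that of the graph it wants to
query. -/
theorem storedGraph_eq_subspacePoint {n m : ℕ} {ρ : ℕ → Bool} (G : SimpleGraph (Fin n))
    (x : Fin m → ZMod 2) (mem : ℕ → ℕ) (base : ℕ)
    (hmem : ∀ b < n * n,
      mem (b + base) = cellValue n m ρ (initState G).mem b (directionList x)) :
    storedGraph n mem base =
      subspacePoint (graphEquiv n) ((graphEquiv n).symm G) (coinDirections n m ρ) x := by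
  classical
  have hentry : ∀ i j : Fin n, mem (base + i * n + j) ≠ 0 ↔ ∃ h : i < j,
      ((graphEquiv n).symm G + ∑ l, x l • coinDirections n m ρ l) ⟨(i, j), h⟩ = 1 := fun i j => by
    rw [add_assoc, add_comm base, hmem _ (cell_lt i j), cellValue, odd_mod_mul_ne_zero, cell_mod,
      cell_div, and_comm, Nat.sub_ne_zero_iff_lt, Fin.val_fin_lt, ← exists_prop]
    refine exists_congr fun h => ?_
    have hM : (((initState G).mem (i * n + j) : ℕ) : ZMod 2) =
        (graphEquiv n).symm G ⟨(i, j), h⟩ := by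
      have hiff : (∃ i' j' : Fin n, (i : ℕ) * n + j = i' * n + j' ∧ G.Adj i' j') ↔ G.Adj i j := by
        constructor
        · rintro ⟨i', j', he, hadj⟩
          have h4 := cell_mod i j
          have h5 := cell_div i j
          rw [he, cell_mod] at h4
          rw [he, cell_div] at h5
          rwa [Fin.ext h4, Fin.ext h5] at hadj
        · exact fun hadj => ⟨i, j, rfl, hadj⟩
      simp only [initState, graphEquiv, Equiv.coe_fn_symm_mk, hiff, Nat.cast_ite, Nat.cast_one,
        Nat.cast_zero]
    rw [Nat.cast_add, hM, sum_map_directionList]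
    simp [coinDirections, coinIndex]
  rw [storedGraph, subspacePoint]
  simp only [hentry]
  rfl

/-- The program succeeds whenever the correct answers come from a reliable set of points. -/
theorem outputs_of_isReliable (k m : ℕ) {n : ℕ} {O : SimpleGraph (Fin n) → ZMod 2} {ρ : ℕ → Bool}
    {S : Finset (SimpleGraph (Fin n))} (hO : ∀ G ∈ S, O G = cliqueParity k G)
    (G : SimpleGraph (Fin n)) (R : Finset (Fin m → ZMod 2))
    (hRS : ∀ x ∈ R,
      subspacePoint (graphEquiv n) ((graphEquiv n).symm G) (coinDirections n m ρ) x ∈ S)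
    (hR : IsReliable (VertexPair k) R) :
    (cliqueProg k m).Outputs O G ρ (cliqueParity k G).val := by
  have h01 : ∀ z : ZMod 2, z ≠ 0 → z = 1 := by decide
  have hls : ∀ l ∈ queryLists m, l.length ≤ m ∧ ∀ i ∈ l, i < m := fun l hl => by
    obtain ⟨x, _, rfl⟩ := List.mem_map.1 hl
    exact directionList_spec x
  obtain ⟨s, t, hexec, -, mem, hmem, hreg⟩ := reaches_decodeProg (O := O) (ρ := ρ) hls
    (decodeAnswers k m) (decodeAnswers_le_one k m) G
  refine ⟨s, t, hexec, ?_⟩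
  set q := subspacePoint (graphEquiv n) ((graphEquiv n).symm G) (coinDirections n m ρ)
  have hstored : ∀ i : Fin (queryLists m).length,
      storedGraph n mem ((i + 1) * (n * n)) = q (queryPoint i) := fun i =>
    storedGraph_eq_subspacePoint G _ mem _ fun b hb => by
      rw [hmem b hb i i.2, queryLists_getElem]
  obtain ⟨a, ha⟩ := exists_lowDegree_eq_cliqueParity k ((graphEquiv n).symm G)
    (coinDirections n m ρ)
  have hG : cliqueParity k G = lowDegree a 0 := by
    rw [← ha 0]
    simp [subspacePoint]
  rw [hreg, hG]
  refine congrArg ZMod.val (decode_eq hR fun x hx hx0 => ?_)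
  obtain ⟨i, rfl⟩ := exists_queryPoint_eq hx0
  rw [← ha, ← hO _ (hRS _ hx)]
  simp only [hstored]
  by_cases h0 : O (q (queryPoint i)) = 0
  · rw [if_neg, h0]
    rintro ⟨j, hj, hj'⟩
    rw [hj, h0] at hj'
    simp at hj'
  · rw [if_pos ⟨i, rfl, by simpa using h0⟩, h01 _ h0]

/-- Restricting a uniformly random function along an injection yields a uniformly random
function. -/
theorem card_filter_comp_injective {A B : Type*} [Fintype A] [DecidableEq A] [Fintype B]
    [DecidableEq B] (ι : A → B) (hι : Function.Injective ι) (P : (A → Bool) → Prop)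
    [DecidablePred P] :
    #{r : B → Bool | P (r ∘ ι)} * Fintype.card (A → Bool) =
      #{v : A → Bool | P v} * Fintype.card (B → Bool) := by
  classical
  let e : A ⊕ ((Set.range ι)ᶜ : Set B) ≃ B :=
    ((Equiv.ofInjective ι hι).sumCongr (Equiv.refl _)).trans (Equiv.Set.sumCompl (Set.range ι))
  have he : ∀ a, e (Sum.inl a) = ι a := fun a => by simp [e]
  let E : (B → Bool) ≃ (A → Bool) × (((Set.range ι)ᶜ : Set B) → Bool) :=
    (e.arrowCongr (Equiv.refl Bool)).symm.trans (Equiv.sumArrowEquivProdArrow _ _ _)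
  have hE : ∀ r, (E r).1 = r ∘ ι := fun r => by
    funext a
    simp [E, Equiv.sumArrowEquivProdArrow, Equiv.arrowCongr, he]
  have h1 : #{r : B → Bool | P (r ∘ ι)} =
      #{v : A → Bool | P v} * Fintype.card (((Set.range ι)ᶜ : Set B) → Bool) := by
    rw [← card_univ (α := ((Set.range ι)ᶜ : Set B) → Bool), ← Finset.card_product]
    refine Finset.card_equiv E fun r => ?_
    simp [← hE]
  rw [h1, Fintype.card_congr E, Fintype.card_prod]
  ring

theorem card_filter_coinDirections {n m T : ℕ} (hT : n * n * m ≤ T)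
    (P : (Fin m → VertexPair n → ZMod 2) → Prop) [DecidablePred P] :
    (#{r : Fin T → Bool | P (coinDirections n m (padCoins r))} : ℝ) /
        #(univ : Finset (Fin T → Bool)) =
      #{w | P w} / Fintype.card (Fin m → VertexPair n → ZMod 2) := by
  let ι : Fin m × VertexPair n → Fin T := fun q => ⟨coinIndex n m q, (coinIndex_lt q).trans_le hT⟩
  have hι : Function.Injective ι := fun q q' h =>
    coinIndex_injective n m (congrArg Fin.val h)
  let b : Bool ≃ ZMod 2 := ⟨fun b => (b.toNat : ℕ), fun z => decide (z = 1), by decide, by decide⟩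
  let D : (Fin m × VertexPair n → Bool) ≃ (Fin m → VertexPair n → ZMod 2) :=
    (Equiv.curry _ _ _).trans (Equiv.piCongrRight fun _ => Equiv.piCongrRight fun _ => b)
  have hD : ∀ r : Fin T → Bool, coinDirections n m (padCoins r) = D (r ∘ ι) := fun r => by
    funext l p
    have : coinIndex n m (l, p) < T := (ι (l, p)).2
    simp [D, b, coinDirections, padCoins, this, ι]
  have h1 := card_filter_comp_injective ι hι fun v => P (D v)
  have h2 : #{v : Fin m × VertexPair n → Bool | P (D v)} = #{w | P w} :=
    Finset.card_equiv D fun v => by simp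
  rw [div_eq_div_iff (by simp) (by exact_mod_cast Fintype.card_ne_zero), card_univ,
    ← Fintype.card_congr D]
  simp only [hD]
  rw [← h2]
  exact_mod_cast h1

open Classical in
/-- If few directions fail at `G`, then the program is correct on input `G` with every oracle that
is correct on `S`. -/
theorem outputProb_cliqueProg (k m : ℕ) {n : ℕ} {O : SimpleGraph (Fin n) → ZMod 2}
    {S : Finset (SimpleGraph (Fin n))} (hO : ∀ G ∈ S, O G = cliqueParity k G)
    (G : SimpleGraph (Fin n)) {T : ℕ} (hT : n * n * m ≤ T)
    (hfail : failureRate (VertexPair k) m (graphEquiv n) ((graphEquiv n).symm G) S < 1 / 3) :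
    2 / 3 < (cliqueProg k m).outputProb O G T (cliqueParity k G).val := by
  set q := subspacePoint (m := m) (graphEquiv n) ((graphEquiv n).symm G)
  have h1 := card_filter_coinDirections hT fun w : Fin m → VertexPair n → ZMod 2 =>
    ¬ IsReliable (VertexPair k) (univ.filter fun x => q w x ∈ S)
  have h2 := h1.trans_lt hfail
  have hpos : (0 : ℝ) < #(univ : Finset (Fin T → Bool)) := by
    exact_mod_cast Finset.card_pos.2 univ_nonempty
  have hcov : (univ : Finset (Fin T → Bool)) ⊆
      (univ.filter fun r => ¬ IsReliable (VertexPair k)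
        (univ.filter fun x => q (coinDirections n m (padCoins r)) x ∈ S)) ∪ univ.filter fun r =>
        (cliqueProg k m).Outputs O G (padCoins r) (cliqueParity k G).val := by
    intro r _
    rw [mem_union, mem_filter, mem_filter]
    by_cases h : IsReliable (VertexPair k)
        (univ.filter fun x => q (coinDirections n m (padCoins r)) x ∈ S)
    · exact Or.inr ⟨mem_univ _, outputs_of_isReliable k m hO G _
        (fun x hx => (mem_filter.1 hx).2) h⟩
    · exact Or.inl ⟨mem_univ _, h⟩
  have h3 : (#(univ : Finset (Fin T → Bool)) : ℝ) ≤
      #(univ.filter fun r : Fin T → Bool => ¬ IsReliable (VertexPair k)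
        (univ.filter fun x => q (coinDirections n m (padCoins r)) x ∈ S)) +
      #(univ.filter fun r : Fin T → Bool =>
        (cliqueProg k m).Outputs O G (padCoins r) (cliqueParity k G).val) := by
    exact_mod_cast (card_le_card hcov).trans (card_union_le _ _)
  rw [RamProg.outputProb, uniformProb, lt_div_iff₀ hpos]
  rw [div_lt_iff₀ hpos] at h2
  linarith

theorem cliqueProg_haltsWithin (k m : ℕ) {n : ℕ} (O : SimpleGraph (Fin n) → ZMod 2)
    (G : SimpleGraph (Fin n)) (ρ : ℕ → Bool) :
    (cliqueProg k m).HaltsWithin O G ρ (decodeCost n m (queryLists m)) := by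
  have hls : ∀ l ∈ queryLists m, l.length ≤ m ∧ ∀ i ∈ l, i < m := fun l hl => by
    obtain ⟨x, _, rfl⟩ := List.mem_map.1 hl
    exact directionList_spec x
  obtain ⟨s, t, hexec, ht, -⟩ := reaches_decodeProg (O := O) (ρ := ρ) hls
    (decodeAnswers k m) (decodeAnswers_le_one k m) G
  exact ⟨s, t, hexec, ht⟩

theorem mul_le_decodeCost (n m : ℕ) (ls : List (List ℕ)) : n * n * m ≤ decodeCost n m ls := by
  have h1 : 1 ≤ unitCost (regBound n m ls) := Nat.one_le_pow _ _ (by omega)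
  calc n * n * m ≤ n * n * (writeAllSteps ls + m + 8) := Nat.mul_le_mul_left _ (by omega)
    _ ≤ n * n * (writeAllSteps ls + m + 8) + 3 * ls.length + 8 := by omega
    _ ≤ (n * n * (writeAllSteps ls + m + 8) + 3 * ls.length + 8) * unitCost (regBound n m ls) :=
      Nat.le_mul_of_pos_right _ h1
    _ ≤ _ := Nat.le_add_right _ _

/-! ### Asymptotics -/

open Filter

theorem isBigO_decodeCost (m : ℕ) (ls : List (List ℕ)) :
    Asymptotics.IsBigO atTop (fun n : ℕ => (decodeCost n m ls : ℝ))
      (fun n : ℕ => (n : ℝ) ^ 2 * Real.log n ^ 2) := by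
  set D : ℕ := ls.length + m + 4 with hD
  have hl2 : 0 < Real.log 2 := Real.log_pos one_lt_two
  set A : ℝ := 2 / Real.log 2 + (Real.log D / Real.log 2 + 2) / Real.log 2 with hA
  set C : ℝ := (writeAllSteps ls + m + 8) + 3 * ls.length + 8 with hC
  have hD1 : (1 : ℝ) ≤ D := by
    have : 1 ≤ D := by omega
    exact_mod_cast this
  have hlD : 0 ≤ Real.log D := Real.log_nonneg hD1
  refine Asymptotics.IsBigO.of_bound (C * A ^ 2 + ls.length / Real.log 2 ^ 2) ?_
  filter_upwards [eventually_ge_atTop 2] with n hn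
  have hn2 : (2 : ℝ) ≤ n := by exact_mod_cast hn
  have hn0 : (0 : ℝ) < n := by linarith
  have hlog : Real.log 2 ≤ Real.log n := Real.log_le_log two_pos hn2
  have hlog0 : 0 < Real.log n := hl2.trans_le hlog
  have hsize : (1 + (regBound n m ls).size : ℝ) ≤ A * Real.log n := by
    set B := regBound n m ls with hB
    have hBle : B ≤ D * (n * n) := by
      rw [hB, regBound, hD]
      have h1 : 4 ≤ n * n := Nat.mul_le_mul hn hn
      have h2 : n ≤ n * n := Nat.le_mul_of_pos_left n (by omega)
      have h3 : m ≤ m * (n * n) := Nat.le_mul_of_pos_right m (by omega)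
      rw [add_mul, add_mul, add_mul]
      omega
    have hBpos : 0 < B := by rw [hB, regBound]; omega
    have hs0 : 0 < B.size := Nat.size_pos.2 hBpos
    have hpow : 2 ^ (B.size - 1) ≤ B := Nat.lt_size.1 (by omega)
    have hpow' : (2 : ℝ) ^ (B.size - 1) ≤ D * (n * n) := by exact_mod_cast hpow.trans hBle
    have h1 := Real.log_le_log (by positivity) hpow'
    rw [Real.log_pow, Real.log_mul (by positivity) (by positivity),
      Real.log_mul hn0.ne' hn0.ne', Nat.cast_sub hs0, Nat.cast_one] at h1
    have h2 : Real.log D ≤ Real.log D / Real.log 2 * Real.log n := by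
      rw [div_mul_eq_mul_div, le_div_iff₀ hl2]
      exact mul_le_mul_of_nonneg_left hlog hlD
    have h3 : (B.size : ℝ) - 1 ≤ (Real.log D / Real.log 2 + 2) / Real.log 2 * Real.log n := by
      rw [div_mul_eq_mul_div, le_div_iff₀ hl2]
      linarith
    have h4 : (2 : ℝ) ≤ 2 / Real.log 2 * Real.log n := by
      rw [div_mul_eq_mul_div, le_div_iff₀ hl2]
      linarith
    rw [hA, add_mul]
    linarith
  have hunit : (unitCost (regBound n m ls) : ℝ) ≤ A ^ 2 * Real.log n ^ 2 := by
    rw [unitCost, ← mul_pow]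
    push_cast
    exact pow_le_pow_left₀ (by positivity) hsize 2
  have hcount : ((n * n * (writeAllSteps ls + m + 8) + 3 * ls.length + 8 : ℕ) : ℝ) ≤
      C * (n : ℝ) ^ 2 := by
    have h1 : (1 : ℝ) ≤ (n : ℝ) ^ 2 := by nlinarith
    push_cast
    rw [hC]
    have h2 : (3 * (ls.length : ℝ) + 8) * 1 ≤ (3 * (ls.length : ℝ) + 8) * (n : ℝ) ^ 2 :=
      mul_le_mul_of_nonneg_left h1 (by positivity)
    linarith
  have hlen : (ls.length : ℝ) * (n : ℝ) ^ 2 ≤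
      ls.length / Real.log 2 ^ 2 * ((n : ℝ) ^ 2 * Real.log n ^ 2) := by
    have : 1 ≤ Real.log n ^ 2 / Real.log 2 ^ 2 := by
      rw [one_le_div (by positivity)]
      exact pow_le_pow_left₀ hl2.le hlog 2
    calc _ ≤ (ls.length : ℝ) * (n : ℝ) ^ 2 * (Real.log n ^ 2 / Real.log 2 ^ 2) :=
          le_mul_of_one_le_right (by positivity) this
      _ = _ := by ring
  rw [Real.norm_of_nonneg (Nat.cast_nonneg _), Real.norm_of_nonneg (by positivity), decodeCost]
  have hprod := mul_le_mul hcount hunit (Nat.cast_nonneg _) (by positivity)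
  push_cast at hprod ⊢
  linarith

/-- The exponential gain from the large supports beats the number of low degree functions. -/
theorem exists_dimension (D : ℕ) {θ : ℝ} (hθ : 0 < θ) (hθ' : θ < 1) :
    ∃ j : ℕ, (2 : ℝ) ^ (D + 1 + j + 1) ^ D * θ ^ (2 ^ j - 1) ≤ 1 / 16 := by
  have hc : 0 < -Real.log θ := by linarith [Real.log_neg hθ hθ']
  set c := -Real.log θ with hcdef
  have hl2 : 0 < Real.log 2 := Real.log_pos one_lt_two
  have h1 : Tendsto (fun N : ℕ => (N : ℝ) ^ D / 2 ^ N) atTop (nhds 0) :=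
    tendsto_pow_const_div_const_pow_of_one_lt D one_lt_two
  have hδ : 0 < c / 2 / Real.log 2 / 2 ^ (D + 2) := by positivity
  have h2 := (h1.comp (tendsto_add_atTop_nat (D + 2))).eventually_lt_const hδ
  have h3 : Tendsto (fun j : ℕ => (2 : ℝ) ^ j) atTop atTop :=
    tendsto_pow_atTop_atTop_of_one_lt one_lt_two
  obtain ⟨j, hj, hj'⟩ := (h2.and (h3.eventually_ge_atTop ((c + Real.log 16) / (c / 2)))).exists
  refine ⟨j, ?_⟩
  have hN : D + 1 + j + 1 = j + (D + 2) := by omega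
  rw [hN]
  simp only [Function.comp_apply] at hj
  rw [div_lt_div_iff₀ (by positivity) (by positivity), pow_add (2 : ℝ) j] at hj
  have hj1 : ((j + (D + 2) : ℕ) : ℝ) ^ D * Real.log 2 ≤ c / 2 * 2 ^ j := by
    have h4 : ((j + (D + 2) : ℕ) : ℝ) ^ D * 2 ^ (D + 2) * Real.log 2 ≤
        c / 2 * 2 ^ j * 2 ^ (D + 2) := by
      calc _ ≤ (c / 2 / Real.log 2 * (2 ^ j * 2 ^ (D + 2))) * Real.log 2 :=
            mul_le_mul_of_nonneg_right hj.le hl2.le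
        _ = _ := by field_simp
    have h5 : (0 : ℝ) < 2 ^ (D + 2) := by positivity
    nlinarith
  rw [div_le_iff₀ (by positivity)] at hj'
  rw [← Real.log_le_log_iff (by positivity) (by norm_num), Real.log_mul (by positivity)
    (by positivity), Real.log_pow, Real.log_pow, one_div, Real.log_inv,
    Nat.cast_sub Nat.one_le_two_pow]
  push_cast at hj1 ⊢
  have : Real.log θ = -c := by rw [hcdef, neg_neg]
  rw [this]
  linarith

open Classical in
theorem uniformProb_exists_le {α ι : Type*} [Fintype ι] (Ω : Finset α) (E : ι → α → Prop) :
    uniformProb Ω (fun S => ∃ i, E i S) ≤ ∑ i, uniformProb Ω (E i) := by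
  simp only [uniformProb]
  rw [← Finset.sum_div]
  refine div_le_div_of_nonneg_right ?_ (Nat.cast_nonneg _)
  refine le_trans (Nat.cast_le.2 (card_le_card
    (t := univ.biUnion fun i => Ω.filter (E i)) fun S => ?_)) ?_
  · simp
  · exact_mod_cast card_biUnion_le

theorem one_sub_uniformProb_le {α : Type*} {Ω : Finset α} (hΩ : Ω.Nonempty) {E F : α → Prop}
    (h : ∀ S, ¬ F S → E S) : 1 - uniformProb Ω F ≤ uniformProb Ω E := by
  classical
  have hpos : (0 : ℝ) < #Ω := by exact_mod_cast hΩ.card_pos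
  have hsub : Ω ⊆ Ω.filter F ∪ Ω.filter E := fun S hS => by
    by_cases hF : F S
    · exact mem_union_left _ (mem_filter.2 ⟨hS, hF⟩)
    · exact mem_union_right _ (mem_filter.2 ⟨hS, h S hF⟩)
  have h1 : (#Ω : ℝ) ≤ #(Ω.filter F) + #(Ω.filter E) := by
    exact_mod_cast (card_le_card hsub).trans (card_union_le _ _)
  rw [sub_le_iff_le_add, uniformProb, uniformProb, ← add_div, one_le_div hpos, add_comm]
  convert h1

theorem eventually_mul_exp_le {κ : ℝ} (hκ : 0 < κ) :
    ∀ᶠ x : ℝ in atTop, x * ((x + 1) * Real.exp (-(κ * x))) ≤ 1 / x := by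
  have h1 : Tendsto (fun x : ℝ => x ^ 3 * Real.exp (-x)) atTop (nhds 0) :=
    Real.tendsto_pow_mul_exp_neg_atTop_nhds_zero 3
  have h2 := h1.comp (tendsto_id.const_mul_atTop hκ)
  have h3 := h2.eventually_lt_const (show (0 : ℝ) < κ ^ 3 / 2 by positivity)
  filter_upwards [h3, eventually_ge_atTop 1] with x hx hx1
  simp only [Function.comp_apply, id_eq] at hx
  have hx0 : 0 < x := by linarith
  rw [le_div_iff₀ hx0]
  set e := Real.exp (-(κ * x))
  have he : 0 < e := Real.exp_pos _
  have h4 : x ^ 3 * e < 1 / 2 := by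
    have h5 : κ ^ 3 * (x ^ 3 * e) < κ ^ 3 * (1 / 2) := by
      calc _ = (κ * x) ^ 3 * e := by ring
        _ < _ := hx
        _ = _ := by ring
    exact lt_of_mul_lt_mul_left h5 (by positivity)
  have h6 : x ^ 2 * e ≤ x ^ 3 * e :=
    mul_le_mul_of_nonneg_right (pow_le_pow_right₀ hx1 (by norm_num)) he.le
  nlinarith

theorem rpow_le_two_pow_choose {n : ℕ} (hn : 2 ≤ n) :
    (2 : ℝ) ^ (1 / 4 * (n : ℝ) ^ 2) ≤ 2 ^ n.choose 2 := by
  rw [← Real.rpow_natCast 2 (n.choose 2)]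
  refine Real.rpow_le_rpow_of_exponent_le one_le_two ?_
  have hn2 : (2 : ℝ) ≤ n := by exact_mod_cast hn
  rw [Nat.cast_choose_two]
  nlinarith

theorem tendsto_two_pow_choose :
    Tendsto (fun n : ℕ => (2 : ℝ) ^ n.choose 2) atTop atTop := by
  refine (tendsto_pow_atTop_atTop_of_one_lt one_lt_two).comp ?_
  refine tendsto_atTop_mono' _ ?_ (tendsto_sub_atTop_nat 1)
  filter_upwards [eventually_ge_atTop 2] with n hn
  rw [Nat.choose_two_right, Nat.le_div_iff_mul_le two_pos, mul_comm]
  exact Nat.mul_le_mul_right _ hn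

/-- For almost all sets `S`, the failure rate at every graph is below `1 / 3`. -/
theorem uniformProb_exists_failureRate_le {E : Type*} [DecidableEq E] [Fintype E] {m n M r : ℕ}
    {y θ : ℝ} (hy : 1 ≤ y)
    (hr : ∀ a : (E → Option (Fin m)) → ZMod 2, lowDegree a 0 = 1 →
      r ≤ #{x | x ≠ 0 ∧ lowDegree a x = 1})
    (hM : M ≤ 2 ^ n.choose 2) (hθ1 : θ ≤ 1)
    (hθ : (M : ℝ) / 2 ^ n.choose 2 / y + (1 - (M : ℝ) / 2 ^ n.choose 2) * y ≤ θ)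
    (hmean : 2 ^ m / 2 ^ n.choose 2 + 2 ^ (m + 1) ^ Fintype.card E * θ ^ r ≤ (1 / 8 : ℝ)) :
    uniformProb (powersetCard M (univ : Finset (SimpleGraph (Fin n))))
      (fun S => ∃ G, 1 / 3 ≤ failureRate E m (graphEquiv n) ((graphEquiv n).symm G) S) ≤
      2 ^ n.choose 2 * ((2 ^ n.choose 2 + 1) *
        Real.exp (-(1 / (96 * 4 ^ m) * 2 ^ n.choose 2))) := by
  classical
  have hcard : Fintype.card (SimpleGraph (Fin n)) = 2 ^ n.choose 2 := by
    rw [← Fintype.card_congr (graphEquiv n), card_graph]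
  have hcard' : (Fintype.card (SimpleGraph (Fin n)) : ℝ) = 2 ^ n.choose 2 := by
    rw [hcard]; push_cast; rfl
  have hV : (Fintype.card (VertexPair n → ZMod 2) : ℝ) = 2 ^ n.choose 2 := by
    rw [card_graph]; push_cast; rfl
  have hL : (0 : ℝ) < 2 ^ n.choose 2 := by positivity
  set p : ℝ := (M : ℝ) / 2 ^ n.choose 2 with hp
  have hp0 : 0 ≤ p := by positivity
  have hp1 : p ≤ 1 := (div_le_one hL).2 (by exact_mod_cast hM)
  have hq0 : 0 ≤ 1 - p := by linarith
  have hm : ∀ g, bernoulliMean p univ (failureRate E m (graphEquiv n) g) ≤ 1 / 8 := fun g => by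
    refine (bernoulliMean_failureRate_le hp0 hp1 hy (hθ.trans hθ1) r hr (graphEquiv n) g).trans
      (le_trans ?_ hmean)
    rw [hV]
    have hfun : (Fintype.card ((E → Option (Fin m)) → ZMod 2) : ℝ) =
        2 ^ (m + 1) ^ Fintype.card E := by
      rw [Fintype.card_fun, ZMod.card, Fintype.card_fun, Fintype.card_option, Fintype.card_fin]
      push_cast
      rfl
    rw [hfun]
    gcongr
  refine (uniformProb_exists_le _ _).trans ?_
  calc _ ≤ ∑ _G : SimpleGraph (Fin n), (2 ^ n.choose 2 + 1) *
        Real.exp (-(1 / (96 * 4 ^ m) * 2 ^ n.choose 2)) := by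
        refine Finset.sum_le_sum fun G _ => ?_
        refine (uniformProb_powersetCard_le M (hM.trans_eq hcard.symm) Fintype.card_pos _).trans ?_
        rw [hcard']
        refine mul_le_mul_of_nonneg_left ?_ (by positivity)
        have := bernoulliMean_failureRate_ge_le hp0 hp1 (graphEquiv n)
          ((graphEquiv n).symm G) (hm _)
        rw [hV] at this
        refine this.trans_eq ?_
        congr 1
        ring
    _ = _ := by
        rw [Finset.sum_const, card_univ, nsmul_eq_mul, hcard']

theorem theorem2 (k : ℕ) (hk : 2 < k) (ε : ℝ) (hε : 0 < ε) (hε' : ε ≤ 1 / 2) :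
    ∃ (P : RamProg) (T : ℕ → ℕ) (d : ℕ) (c : ℝ), 0 < c ∧
      -- the running time is `Õ(n ^ 2)`, for every oracle, every input and all coins
      Asymptotics.IsBigO Filter.atTop (fun n : ℕ => (T n : ℝ))
        (fun n : ℕ => (n : ℝ) ^ 2 * Real.log n ^ d) ∧
      (∀ (n : ℕ) (O : SimpleGraph (Fin n) → ZMod 2) (G : SimpleGraph (Fin n)) (ρ : ℕ → Bool),
        P.HaltsWithin O G ρ (T n)) ∧
      -- for almost all sets `S`, every oracle that is correct on `S` can be corrected everywhere
      ∀ᶠ n : ℕ in Filter.atTop,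
        1 - (2 : ℝ) ^ (-(c * (n : ℝ) ^ 2)) ≤
          uniformProb (correctSets n (1 / 2 + ε)) fun S =>
            ∀ O : SimpleGraph (Fin n) → ZMod 2, (∀ G ∈ S, O G = cliqueParity k G) →
              ∀ G : SimpleGraph (Fin n),
                2 / 3 < P.outputProb O G (T n) (cliqueParity k G).val := by
  classical
  -- `y` and `θ` are the parameters of the Chernoff bound for densities of at least `1 / 2 + ε / 2`.
  set y : ℝ := 1 + ε with hy
  have hy0 : 0 < y := by linarith
  set θ : ℝ := (1 / 2 + ε / 2) / y + (1 - (1 / 2 + ε / 2)) * y with hθ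
  have hθ0 : 0 < θ := by
    have h1 : 0 < 1 / 2 + ε / 2 := by linarith
    have h2 : 0 ≤ 1 - (1 / 2 + ε / 2) := by linarith
    positivity
  have hθ1 : θ < 1 := by
    have h1 : θ * y = 1 / 2 + ε / 2 + (1 - (1 / 2 + ε / 2)) * y ^ 2 := by
      rw [hθ]
      field_simp
    have h2 : θ * y < 1 * y := by
      rw [h1, hy]
      nlinarith [mul_pos hε hε, mul_pos hε (mul_pos hε hε)]
    exact lt_of_mul_lt_mul_right h2 hy0.le
  set D := Fintype.card (VertexPair k) with hD
  obtain ⟨j, hj⟩ := exists_dimension D hθ0 hθ1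
  -- With this `m`, the supports of low degree functions have at least `2 ^ j` points.
  set m := D + 1 + j with hm
  have hr : ∀ a : (VertexPair k → Option (Fin m)) → ZMod 2, lowDegree a 0 = 1 →
      2 ^ j - 1 ≤ #{x | x ≠ 0 ∧ lowDegree a x = 1} := fun a ha => by
    have h1 := card_le_card_support_lowDegree a ha
    have hpow : 2 ^ m = 2 ^ (D + 1) * 2 ^ j := by rw [hm, pow_add]
    rw [Fintype.card_fin, hpow] at h1
    have h2 := Nat.le_of_mul_le_mul_left h1 (by positivity)
    have h3 : ({x | lowDegree a x = 1} : Finset (Fin m → ZMod 2)) ⊆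
        insert 0 ({x | x ≠ 0 ∧ lowDegree a x = 1} : Finset (Fin m → ZMod 2)) := by
      intro x hx
      by_cases hx0 : x = 0
      · simp [hx0]
      · simp only [mem_filter, mem_univ, true_and] at hx
        simp [hx0, hx]
    have h4 := (card_le_card h3).trans (card_insert_le _ _)
    have h5 : 2 ^ j ≤ #({x | lowDegree a x = 1} : Finset (Fin m → ZMod 2)) := by
      convert h2
    omega
  refine ⟨cliqueProg k m, fun n => decodeCost n m (queryLists m), 2, 1 / 4, by norm_num,
    isBigO_decodeCost m _, fun n O G ρ => cliqueProg_haltsWithin k m O G ρ, ?_⟩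
  have hκ : (0 : ℝ) < 1 / (96 * 4 ^ m) := by positivity
  filter_upwards [eventually_ge_atTop 2,
    tendsto_two_pow_choose.eventually (eventually_mul_exp_le hκ),
    tendsto_two_pow_choose.eventually (eventually_ge_atTop (16 * 2 ^ m : ℝ)),
    tendsto_two_pow_choose.eventually (eventually_ge_atTop (2 / ε : ℝ))] with n hn hexp hLm hLε
  have hL : (0 : ℝ) < 2 ^ n.choose 2 := by positivity
  set M : ℕ := ⌊(1 / 2 + ε) * (2 : ℝ) ^ n.choose 2⌋₊ with hMdef
  have hM : M ≤ 2 ^ n.choose 2 := by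
    refine Nat.floor_le_of_le ?_
    push_cast
    exact mul_le_of_le_one_left hL.le (by linarith)
  have hp : 1 / 2 + ε / 2 ≤ (M : ℝ) / 2 ^ n.choose 2 := by
    rw [le_div_iff₀ hL]
    have h1 := Nat.lt_floor_add_one ((1 / 2 + ε) * (2 : ℝ) ^ n.choose 2)
    rw [← hMdef] at h1
    rw [div_le_iff₀ hε] at hLε
    linarith
  have hθ' : (M : ℝ) / 2 ^ n.choose 2 / y + (1 - (M : ℝ) / 2 ^ n.choose 2) * y ≤ θ := by
    have h1 : 1 / y ≤ y := by
      rw [div_le_iff₀ hy0]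
      nlinarith
    have h2 : 0 ≤ ((M : ℝ) / 2 ^ n.choose 2 - (1 / 2 + ε / 2)) * (y - 1 / y) :=
      mul_nonneg (by linarith) (by linarith)
    rw [hθ, div_eq_mul_one_div _ y, div_eq_mul_one_div (1 / 2 + ε / 2) y]
    linarith
  have hmean : 2 ^ m / 2 ^ n.choose 2 + 2 ^ (m + 1) ^ D * θ ^ (2 ^ j - 1) ≤ (1 / 8 : ℝ) := by
    have h1 : (2 : ℝ) ^ m / 2 ^ n.choose 2 ≤ 1 / 16 := by
      rw [div_le_iff₀ hL]
      linarith
    linarith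
  have hΩ : (correctSets n (1 / 2 + ε)).Nonempty := by
    rw [correctSets, Finset.powersetCard_nonempty, card_univ,
      ← Fintype.card_congr (graphEquiv n), card_graph]
    exact hM
  have hfail := uniformProb_exists_failureRate_le (E := VertexPair k) (by linarith) hr hM hθ1.le
    hθ' hmean
  have hrpow : 1 / (2 : ℝ) ^ n.choose 2 ≤ 2 ^ (-(1 / 4 * (n : ℝ) ^ 2)) := by
    rw [Real.rpow_neg two_pos.le, ← one_div]
    exact one_div_le_one_div_of_le (by positivity) (rpow_le_two_pow_choose hn)
  have hbad := (hfail.trans hexp).trans hrpow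
  refine le_trans ?_ (one_sub_uniformProb_le hΩ (F := fun S => ∃ G, 1 / 3 ≤
    failureRate (VertexPair k) m (graphEquiv n) ((graphEquiv n).symm G) S) fun S hS O hO G => ?_)
  · exact sub_le_sub_left hbad 1
  · refine outputProb_cliqueProg k m hO G (mul_le_decodeCost n m _) ?_
    exact not_le.1 fun h => hS ⟨G, h⟩
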